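/- A multigraph $G$ is a finite vertex set $V(G)$ with a root $r$ and multiplicities $\omega_G(\{u,v\})\in\mathbb N=\{0,1,2,\dots\}$ for $u\neq v$ (no loops). Let $\widetilde V(G)=V(G)\setminus\{r\}$, $\#E(G)=\sum_e\omega_G(e)$, and $\deg^G_U(i)=\sum_{j\in V(G)\setminus U}\omega_G(\{i,j\})$ for $i\in U\subseteq\widetilde V(G)$. $G$ is connected if every nonempty $U\subseteq\widetilde V(G)$ contains some $i$ with $\deg^G_U(i)\ge1$. Let $\mathrm{PF}(G)$ be the set of $\alpha\colon\widetilde V(G)\to\mathbb N$ such that every nonempty $U\subseteq\widetilde V(G)$ contains some $i$ with $\alpha_i\le\deg^G_U(i)-1$, and let $\mathrm{rsum}(\alpha)=\#E(G)-\#\widetilde V(G)-\sum_i\alpha_i$. Let $\mathrm{SPT}(G)$ be the set of spanning trees of $G$, i.e. trees $T$ on $V(G)$ with $\omega_G(e)\ge1$ for all $e\in E(T)$ (parallel edges are not distinguished). Root $T$ at $r$; write $i\le_T j$ if the path in $T$ from $j$ to $r$ passes through $i$, and $\mathrm{par}_T(i)$ for the parent of $i\ne r$. For a (strict) total order $\prec$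 on $\widetilde V(G)$ put \[\kappa(G,T,\prec)=\sum_{\substack{i,j\in\widetilde V(G)\\ i\le_T j,\ j\prec i}}\omega_G(\{\mathrm{par}_T(i),j\}).\] Finally, $[k]_q=1+q+\dots+q^{k-1}$, with $q$ an indeterminate. **Theorem.** (1) For every connected multigraph $G$ and every total order $\prec$ on $\widetilde V(G)$, \[\sum_{\alpha\in\mathrm{PF}(G)}q^{\mathrm{rsum}(\alpha)}=\sum_{T\in\mathrm{SPT}(G)}q^{\kappa(G,T,\prec)}\prod_{e\in E(T)}[\omega_G(e)]_q .\] (2) In particular, if moreover $G$ is simple (all $\omega_G(e)\le1$), then $\sum_{\alpha\in\mathrm{PF}(G)}q^{\mathrm{rsum}(\alpha)}=\sum_{T\in\mathrm{SPT}(G)}q^{\kappa(G,T,\prec)}$. (3) Let $n,a,b\ge1$, and let $K=K^{a,b}_{n+1}$ be the multigraph on $\{0,\dots,n\}$ with root $0$, $\omega_K(\{0,i\})=a$ for $i\ge1$, and $\omega_K(\{i,j\})=b$ for distinct $i,j\ge1$. For $\mathbf x=(x_1,\dots,x_n)=(a,b,\dots,b)$ let $\mathrm{PF}(\mathbf x)$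 be the set of $\alpha\in\mathbb N^n$ whose weakly increasing rearrangement $\beta_1\le\dots\le\beta_n$ satisfies $\beta_j\le x_1+\dots+x_j-1$ for all $j$, and let $\mathrm{rsum}(\alpha)=\sum_{i=1}^n(n+1-i)x_i-n-\sum_{i=1}^n\alpha_i$. Then $\mathrm{PF}(\mathbf x)=\mathrm{PF}(K)$, and for every total order $\prec$ on $\{1,\dots,n\}$, \[\sum_{\alpha\in\mathrm{PF}(\mathbf x)}q^{\mathrm{rsum}(\alpha)}=\sum_{T\in\mathrm{SPT}(K)}q^{\kappa(K,T,\prec)}\prod_{e\in E(T)}[\omega_K(e)]_q .\] -/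

import Mathlib

noncomputable section

/-- A finite loopless multigraph on the vertex set `V`, with a distinguished root vertex.
`weight s(u, v)` is the number of parallel edges joining `u` and `v`. -/
structure RootedMultigraph (V : Type*) where
  weight : Sym2 V → ℕ
  weight_diag : ∀ v : V, weight s(v, v) = 0
  root : V

namespace RootedMultigraph

variable {V : Type*}

/-- The non-root vertices. -/
abbrev NonRoot (G : RootedMultigraph V) : Type _ := {v : V // v ≠ G.root}

section Parking

variable [Fintype V] [DecidableEq V] (G : RootedMultigraph V)

/-- The number of edges, counted with multiplicity. -/
def edgeCount : ℕ := ∑ e : Sym2 V, G.weight e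

/-- For a set `U` of non-root vertices and a vertex `i`, the number of edges (with multiplicity)
that join `i` to vertices outside `U`. -/
def degOut (U : Finset G.NonRoot) (i : V) : ℕ :=
  ∑ j ∈ Finset.univ \ U.map (Function.Embedding.subtype _), G.weight s(i, j)

/-- Every nonempty set of non-root vertices has an element joined by an edge to its complement. -/
def Connected : Prop :=
  ∀ U : Finset G.NonRoot, U.Nonempty → ∃ i ∈ U, 1 ≤ G.degOut U i

/-- `α` is a parking function of `G`: every nonempty set `U` of non-root vertices contains some `i`
with `α i ≤ degOut U i - 1`. -/
def IsParking (α : G.NonRoot → ℕ) : Prop :=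
  ∀ U : Finset G.NonRoot, U.Nonempty → ∃ i ∈ U, α i < G.degOut U i

theorem finite_isParking : {α : G.NonRoot → ℕ | G.IsParking α}.Finite := by
  refine (Set.finite_Iic (fun i : G.NonRoot => G.degOut {i} i)).subset ?_
  intro α hα i
  obtain ⟨j, hj, hlt⟩ := hα {i} (Finset.singleton_nonempty i)
  rw [Finset.mem_singleton] at hj
  subst hj
  exact hlt.le

/-- The finite set of parking functions of `G`. -/
def parkingFunctions : Finset (G.NonRoot → ℕ) := G.finite_isParking.toFinset

/-- The reversed sum `#E(G) - n - ∑ α i`, where `n` is the number of non-root vertices. -/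
def rsum (α : G.NonRoot → ℕ) : ℤ :=
  (G.edgeCount : ℤ) - (Fintype.card G.NonRoot : ℤ) - ∑ i, (α i : ℤ)

end Parking

/-- A spanning tree of `G`: a tree on the whole vertex set `V`, all of whose edges are edges of `G`.
Parallel edges of `G` are not distinguished. -/
structure SpanningTree (G : RootedMultigraph V) where
  graph : SimpleGraph V
  isTree : graph.IsTree
  weight_pos : ∀ e ∈ graph.edgeSet, 1 ≤ G.weight e

theorem SpanningTree.graph_injective (G : RootedMultigraph V) :
    Function.Injective (SpanningTree.graph : G.SpanningTree → SimpleGraph V) := by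
  rintro ⟨S, _, _⟩ ⟨T, _, _⟩ h
  cases h
  rfl

instance [Finite V] (G : RootedMultigraph V) : Fintype G.SpanningTree :=
  haveI := Finite.of_injective _ (SpanningTree.graph_injective G)
  Fintype.ofFinite _

namespace SpanningTree

variable {G : RootedMultigraph V} (T : G.SpanningTree)

/-- The unique path in `T` from `i` to the root. -/
def pathToRoot (i : V) : T.graph.Walk i G.root :=
  (T.isTree.existsUnique_path i G.root).choose

/-- The tree order: `i ≤ j` if and only if the path in `T` from `j` to the root passes through `i`. -/
def Le (i j : V) : Prop := i ∈ (T.pathToRoot j).support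

/-- The parent of a non-root vertex `i`: the vertex after `i` on the path from `i` to the root. -/
def parent (i : G.NonRoot) : V := (T.pathToRoot i).snd

open Classical in
/-- The edge set of `T`. -/
def edges [Fintype V] : Finset (Sym2 V) := {e | e ∈ T.graph.edgeSet}

open Classical in
/-- The generalized inversion number `κ(G, T, ≺)`: the sum, over all pairs `(i, j)` of non-root
vertices with `i ≤_T j` and `j ≺ i`, of the multiplicity in `G` of `{parent i, j}`. -/
def kappa [Fintype V] (prec : G.NonRoot → G.NonRoot → Prop) : ℕ :=
  ∑ i : G.NonRoot, ∑ j : G.NonRoot,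
    if T.Le i j ∧ prec j i then G.weight s(T.parent i, (j : V)) else 0

end SpanningTree

/-- The multigraph `K^{a,b}` on `{0, …, n}`, rooted at `0`: each edge at `0` has multiplicity `a`,
and each other edge has multiplicity `b`. -/
def completeAB (n a b : ℕ) : RootedMultigraph (Fin (n + 1)) where
  weight e := if e.IsDiag then 0 else if 0 ∈ e then a else b
  weight_diag v := by simp
  root := 0

end RootedMultigraph

/-- The `q`-number `1 + q + ⋯ + q ^ (k - 1)`, a Laurent polynomial in `q`. -/
def qNumber (k : ℕ) : LaurentPolynomial ℤ := ∑ i ∈ Finset.range k, LaurentPolynomial.T (i : ℤ)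

namespace VectorParking

variable {n : ℕ}

/-- `α` is an `x`-parking function: in its weakly increasing rearrangement, the `j`-th entry is at
most `x 1 + ⋯ + x j - 1`. (Indices start at `0` in the code.) -/
def IsParking (x α : Fin n → ℕ) : Prop :=
  ∀ j : Fin n, α (Tuple.sort α j) < ∑ k ∈ Finset.Iic j, x k

theorem finite_isParking (x : Fin n → ℕ) : {α : Fin n → ℕ | IsParking x α}.Finite := by
  refine (Set.finite_Iic (fun _ : Fin n => ∑ k, x k)).subset ?_
  intro α hα i
  have h := hα ((Tuple.sort α).symm i)
  rw [Equiv.apply_symm_apply] at h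
  exact h.le.trans (Finset.sum_le_sum_of_subset (Finset.subset_univ _))

/-- The finite set of `x`-parking functions. -/
def parkingFunctions (x : Fin n → ℕ) : Finset (Fin n → ℕ) := (finite_isParking x).toFinset

/-- The reversed sum `(∑ (n + 1 - i) x i) - n - ∑ α i`, where `i` runs through `1, …, n`.
(Indices start at `0` in the code.) -/
def rsum (x α : Fin n → ℕ) : ℤ :=
  (∑ i : Fin n, ((n : ℤ) - (i : ℤ)) * (x i : ℤ)) - (n : ℤ) - ∑ i, (α i : ℤ)

/-- The vector `(a, b, b, …, b)`. -/
def vecAB (n a b : ℕ) : Fin n → ℕ := fun i => if (i : ℕ) = 0 then a else b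

end VectorParking

end

set_option linter.unusedSectionVars false

/-! Both sides, multiplied by `(q - 1) ^ n` with `n` the number of non-root vertices, equal one
value of a set function `C` that does not involve the order. Put `A X = q ^ edgesIn ω X`. Expanding
`q = 1 + (q - 1)` on every edge makes `A X` a sum over edge subsets; `C X` is its part from
connected spanning subgraphs, that is, the logarithm of `A` under subset convolution. Algebraically,
restriction to sets containing `r` is a derivation `mark r`, and for `r ∈ X` the value `C X` is that
of the logarithmic derivative `mark r A / A` (`SetFunction.exists_connected_part`).

Trees: deleting `r` and isolating the component `B` of a fixed vertex `m` gives a recursion for `C`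
with factor `q ^ (∑ j ∈ B, ω s(r, j)) - 1`. Cutting the branch at `r` that contains `m` gives the
same recursion for the tree sum: the branch may be rooted at any `v ∈ B`, and the `κ`-weights of
these choices telescope to that factor (`sum_telescope`, `treeSum_eq_of_recursion`).

Parking functions: every function on `W` splits uniquely into a maximal blocked part and a parking
function on the rest. With `t = q⁻¹`, the resulting generating function identity says that the
normalized parking sum `f` satisfies `f * A = mark r A` (`pow_edgesIn_eq_sum_parkingSum`). As `A` is
invertible, `f` is the logarithmic derivative, hence `parkingSum_eq_treeSum`. -/

noncomputable section

/-! ### The subset convolution ring and logarithmic derivatives. -/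

/-- Functions on finite subsets of `V`, multiplied by subset convolution. -/
@[ext]
structure SetFunction (V R : Type*) where
  toFun : Finset V → R

namespace SetFunction

variable {V R : Type*} [DecidableEq V] [CommRing R]

instance : CoeFun (SetFunction V R) (fun _ => Finset V → R) := ⟨toFun⟩

instance : Zero (SetFunction V R) := ⟨⟨fun _ => 0⟩⟩
instance : One (SetFunction V R) := ⟨⟨fun X => if X = ∅ then 1 else 0⟩⟩
instance : Add (SetFunction V R) := ⟨fun f g => ⟨fun X => f X + g X⟩⟩
instance : Neg (SetFunction V R) := ⟨fun f => ⟨fun X => - f X⟩⟩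
instance : Mul (SetFunction V R) := ⟨fun f g => ⟨fun X => ∑ B ∈ X.powerset, f B * g (X \ B)⟩⟩

theorem zero_apply (X : Finset V) : (0 : SetFunction V R) X = 0 := rfl
theorem one_apply (X : Finset V) : (1 : SetFunction V R) X = if X = ∅ then 1 else 0 := rfl
theorem add_apply (f g : SetFunction V R) (X : Finset V) : (f + g) X = f X + g X := rfl
theorem neg_apply (f : SetFunction V R) (X : Finset V) : (-f) X = - f X := rfl
theorem mul_apply (f g : SetFunction V R) (X : Finset V) :
    (f * g) X = ∑ B ∈ X.powerset, f B * g (X \ B) := rfl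

theorem ext_apply {f g : SetFunction V R} (h : ∀ X, f X = g X) : f = g :=
  SetFunction.ext (funext h)

theorem mul_comm_apply (f g : SetFunction V R) : f * g = g * f := by
  refine ext_apply fun X => ?_
  rw [mul_apply, mul_apply]
  refine Finset.sum_nbij' (fun B => X \ B) (fun B => X \ B) ?_ ?_ ?_ ?_ ?_
  · intro B _; simp
  · intro B _; simp
  · intro B hB; simpa using hB
  · intro B hB; simpa using hB
  · intro B hB
    rw [Finset.mem_powerset] at hB
    simp only [Finset.sdiff_sdiff_eq_self hB]
    ring

theorem mul_assoc_apply (f g h : SetFunction V R) : f * g * h = f * (g * h) := by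
  refine ext_apply fun X => ?_
  simp only [mul_apply, Finset.sum_mul, Finset.mul_sum]
  rw [Finset.sum_sigma', Finset.sum_sigma']
  refine Finset.sum_nbij' (fun x => ⟨x.2, x.1 \ x.2⟩) (fun x => ⟨x.1 ∪ x.2, x.1⟩) ?_ ?_ ?_ ?_ ?_
  · rintro ⟨B, D⟩ hx
    simp only [Finset.mem_sigma, Finset.mem_powerset] at hx ⊢
    exact ⟨hx.2.trans hx.1, Finset.sdiff_subset_sdiff hx.1 le_rfl⟩
  · rintro ⟨B, D⟩ hx
    simp only [Finset.mem_sigma, Finset.mem_powerset] at hx ⊢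
    exact ⟨Finset.union_subset hx.1 (hx.2.trans Finset.sdiff_subset), Finset.subset_union_left⟩
  · rintro ⟨B, D⟩ hx
    simp only [Finset.mem_sigma, Finset.mem_powerset] at hx ⊢
    rw [Finset.union_sdiff_of_subset hx.2]
  · rintro ⟨B, D⟩ hx
    simp only [Finset.mem_sigma, Finset.mem_powerset] at hx ⊢
    have hd : Disjoint B D := (Finset.subset_sdiff.1 hx.2).2.symm
    rw [Finset.union_sdiff_cancel_left hd]
  · rintro ⟨B, D⟩ hx
    simp only [Finset.mem_sigma, Finset.mem_powerset] at hx ⊢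
    have : (X \ D) \ (B \ D) = X \ B := by
      rw [sdiff_sdiff_left, Finset.sup_eq_union, Finset.union_sdiff_of_subset hx.2]
    rw [this, mul_assoc]

theorem one_mul_apply (f : SetFunction V R) : 1 * f = f := by
  refine ext_apply fun X => ?_
  rw [mul_apply, Finset.sum_eq_single ∅]
  · simp [one_apply]
  · intro B _ hB; simp [one_apply, hB]
  · intro h; simp at h

theorem left_distrib_apply (f g h : SetFunction V R) : f * (g + h) = f * g + f * h := by
  refine ext_apply fun X => ?_
  simp only [mul_apply, add_apply, mul_add, Finset.sum_add_distrib]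

instance : CommRing (SetFunction V R) where
  add_assoc f g h := ext_apply fun X => add_assoc _ _ _
  zero_add f := ext_apply fun X => zero_add _
  add_zero f := ext_apply fun X => add_zero _
  add_comm f g := ext_apply fun X => add_comm _ _
  neg_add_cancel f := ext_apply fun X => neg_add_cancel _
  nsmul := nsmulRec
  zsmul := zsmulRec
  mul_assoc := mul_assoc_apply
  mul_comm := mul_comm_apply
  one_mul := one_mul_apply
  mul_one f := (mul_comm_apply f 1).trans (one_mul_apply f)
  left_distrib := left_distrib_apply
  right_distrib f g h := by
    rw [mul_comm_apply, left_distrib_apply, mul_comm_apply h, mul_comm_apply h]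
  zero_mul f := ext_apply fun X => by simp [mul_apply, zero_apply]
  mul_zero f := ext_apply fun X => by simp [mul_apply, zero_apply]

theorem sub_apply (f g : SetFunction V R) (X : Finset V) : (f - g) X = f X - g X := by
  rw [sub_eq_add_neg, sub_eq_add_neg, add_apply, neg_apply]

/-- Restriction to the sets that contain `m`. -/
def mark (m : V) (f : SetFunction V R) : SetFunction V R := ⟨fun X => if m ∈ X then f X else 0⟩

theorem mark_apply (m : V) (f : SetFunction V R) (X : Finset V) :
    mark m f X = if m ∈ X then f X else 0 := rfl

/-- Leibniz rule: an element of `X` lies in exactly one of `B` and `X \ B`. -/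
theorem mark_mul (m : V) (f g : SetFunction V R) :
    mark m (f * g) = mark m f * g + f * mark m g := by
  refine ext_apply fun X => ?_
  simp only [mark_apply, add_apply, mul_apply, ← Finset.sum_add_distrib]
  split_ifs with h
  · refine Finset.sum_congr rfl fun B _ => ?_
    by_cases hB : m ∈ B <;> simp [hB, h]
  · symm
    refine Finset.sum_eq_zero fun B hB => ?_
    have hm : m ∉ B := fun h' => h (Finset.mem_powerset.1 hB h')
    simp [hm, h]

theorem mark_one (m : V) : mark m (1 : SetFunction V R) = 0 := by
  refine ext_apply fun X => ?_
  simp only [mark_apply, one_apply, zero_apply]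
  split_ifs with h h' <;> simp_all

theorem mark_mark_comm (m v : V) (f : SetFunction V R) :
    mark m (mark v f) = mark v (mark m f) := by
  refine ext_apply fun X => ?_
  simp only [mark_apply]
  split_ifs <;> rfl

/-- Pointwise multiplication by a multiplicative function of the set. -/
def twist (x : V → R) (f : SetFunction V R) : SetFunction V R := ⟨fun X => (∏ j ∈ X, x j) * f X⟩

theorem twist_apply (x : V → R) (f : SetFunction V R) (X : Finset V) :
    twist x f X = (∏ j ∈ X, x j) * f X := rfl

theorem twist_mul (x : V → R) (f g : SetFunction V R) :
    twist x (f * g) = twist x f * twist x g := by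
  refine ext_apply fun X => ?_
  simp only [twist_apply, mul_apply, Finset.mul_sum]
  refine Finset.sum_congr rfl fun B hB => ?_
  rw [← Finset.prod_sdiff (Finset.mem_powerset.1 hB)]
  ring

theorem twist_mark (x : V → R) (m : V) (f : SetFunction V R) :
    twist x (mark m f) = mark m (twist x f) := by
  refine ext_apply fun X => ?_
  simp only [twist_apply, mark_apply]
  split_ifs <;> simp

/-- The indicator function of `{r}`. -/
def atom (r : V) : SetFunction V R := ⟨fun X => if X = {r} then 1 else 0⟩

theorem atom_mul_apply (r : V) (f : SetFunction V R) (X : Finset V) :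
    (atom r * f : SetFunction V R) X = if r ∈ X then f (X.erase r) else 0 := by
  rw [mul_apply]
  split_ifs with h
  · rw [Finset.sum_eq_single {r}]
    · simp [atom, Finset.sdiff_singleton_eq_erase]
    · intro B _ hB; simp [atom, hB]
    · intro h'; simp [h] at h'
  · refine Finset.sum_eq_zero fun B hB => ?_
    have : B ≠ {r} := by
      rintro rfl
      exact h (by simpa using hB)
    simp [atom, this]

theorem mark_atom {m r : V} (h : m ≠ r) : mark m (atom r : SetFunction V R) = 0 := by
  refine ext_apply fun X => ?_
  simp only [mark_apply, atom, zero_apply]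
  split_ifs with h1 h2
  · subst h2; exact absurd (Finset.mem_singleton.1 h1) h
  · rfl
  · rfl

/-- Only partitions into `k` nonempty blocks could contribute, and `X` is too small for that. -/
theorem pow_apply_eq_zero {f : SetFunction V R} (hf : f ∅ = 0) (k : ℕ) :
    ∀ X : Finset V, X.card < k → (f ^ k) X = 0 := by
  induction k with
  | zero => intro X hX; simp at hX
  | succ k ih =>
    intro X hX
    rw [pow_succ, mul_apply]
    refine Finset.sum_eq_zero fun B hB => ?_
    rw [Finset.mem_powerset] at hB
    by_cases h : B.card < k
    · rw [ih B h, zero_mul]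
    · have : B = X := Finset.eq_of_subset_of_card_le hB (by omega)
      rw [this, Finset.sdiff_self, hf, mul_zero]

theorem isUnit_of_apply_empty [Finite V] {f : SetFunction V R} (hf : f ∅ = 1) : IsUnit f := by
  have := Fintype.ofFinite V
  have h0 : (f - 1) ∅ = 0 := by rw [sub_apply, hf, one_apply, if_pos rfl, sub_self]
  have : IsNilpotent (f - 1) := ⟨Fintype.card V + 1, ext_apply fun X => by
    rw [pow_apply_eq_zero h0 _ X (Nat.lt_succ_of_le (Finset.card_le_univ X))]; rfl⟩
  simpa using this.isUnit_one_add

/-- `C` is the logarithm of `A`. The first clause identifies it from any solution of `mark r A = f *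
A`; the last is the recursion in which `B` is the component of `m` once `r` is deleted, and `∏ x r j
- 1` accounts for the nonempty sets of edges from `r` to `B`. -/
theorem exists_connected_part [Finite V] {A : SetFunction V R} (x : V → V → R)
    (hA : A ∅ = 1)
    (hx : ∀ r, mark r A = atom r * twist (x r) A) :
    ∃ C : Finset V → R,
      (∀ f : SetFunction V R, ∀ r, mark r A = f * A → ∀ X, r ∈ X → f X = C X) ∧
      (∀ r, C {r} = 1) ∧
      ∀ r m W, r ∉ W → m ∈ W → C (insert r W) =
        ∑ B ∈ W.powerset, if m ∈ B then (∏ j ∈ B, x r j - 1) * C B * C (insert r (W \ B)) else 0 := by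
  obtain ⟨A', hA'⟩ := isUnit_iff_exists_inv.1 (isUnit_of_apply_empty hA)
  have hinv : ∀ m, mark m A' = - (A' * A' * mark m A) := by
    intro m
    have h := congrArg (mark m) hA'
    rw [mark_mul, mark_one] at h
    linear_combination A' * h - mark m A' * hA'
  set c : V → SetFunction V R := fun r => mark r A * A' with hc
  have hcA : ∀ r, c r * A = mark r A := fun r => by
    simp only [hc]; linear_combination mark r A * hA'
  -- Both sides are the mixed second derivative of `log A`, and marks commute.
  have hsymm : ∀ r m, mark m (c r) = mark r (c m) := by
    intro r m
    simp only [hc, mark_mul, hinv, mark_mark_comm r m]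
    ring
  have hsupp : ∀ r X, r ∉ X → c r X = 0 := by
    intro r X h
    simp only [hc, mul_apply]
    refine Finset.sum_eq_zero fun B hB => ?_
    rw [mark_apply, if_neg fun h' => h (Finset.mem_powerset.1 hB h'), zero_mul]
  -- Differentiate `hx` at `m`: the atom is constant there, so `mark m` acts only on the twisted
  -- factor, and `twist` is multiplicative.
  have hrec : ∀ r m, m ≠ r → mark m (c r) = (twist (x r) (c m) - c m) * c r := by
    intro r m h
    have h1 : mark m (mark r A) = twist (x r) (c m) * c r * A := by
      rw [hx, mark_mul, mark_atom h, zero_mul, zero_add, ← twist_mark, ← hcA, twist_mul,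
        mul_assoc _ (c r), hcA, hx]
      ring
    have h2 : mark m (c r) = mark m (mark r A) * A' + mark r A * mark m A' := by
      simp only [hc, mark_mul]
    rw [h2, h1, hinv, ← hcA r, ← hcA m]
    linear_combination (twist (x r) (c m) * c r - c r * c m * (A * A' + 1)) * hA'
  -- Evaluating `hsymm` on a set containing both points shows that `c r X` does not depend on `r ∈
  -- X`, so `C` is well defined.
  have hind : ∀ r m X, r ∈ X → m ∈ X → c r X = c m X := by
    intro r m X hr hm
    have := congrArg (fun f : SetFunction V R => f X) (hsymm r m)
    simpa [mark_apply, hr, hm] using this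
  obtain ⟨C, hC⟩ : ∃ C : Finset V → R, ∀ X r, r ∈ X → C X = c r X := by
    classical
    refine ⟨fun X => if h : ∃ y, y ∈ X then c h.choose X else 0, fun X r hr => ?_⟩
    have h : ∃ y, y ∈ X := ⟨r, hr⟩
    simp only [dif_pos h]
    exact hind _ _ _ h.choose_spec hr
  refine ⟨C, ?_, ?_, ?_⟩
  · intro f r hf X hr
    have : f = c r := by
      simp only [hc, hf]; linear_combination -f * hA'
    rw [hC X r hr, this]
  · intro r
    rw [hC _ r (Finset.mem_singleton_self r)]
    have h := congrArg (fun f : SetFunction V R => f {r}) (hx r)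
    have h' : A {r} = 1 := by
      simpa [mark_apply, atom_mul_apply, twist_apply, hA] using h
    have hA'1 : A' ∅ = 1 := by
      have := congrArg (fun f : SetFunction V R => f ∅) hA'
      simpa [mul_apply, hA, one_apply] using this
    simp only [hc, mul_apply]
    rw [Finset.sum_eq_single {r}]
    · simp [mark_apply, h', hA'1]
    · intro B hB hne
      rw [Finset.mem_powerset, Finset.subset_singleton_iff] at hB
      rcases hB with rfl | rfl
      · simp [mark_apply]
      · exact absurd rfl hne
    · intro h; simp at h
  · intro r m W hr hm
    have hmr : m ≠ r := fun h => hr (h ▸ hm)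
    rw [hC _ r (Finset.mem_insert_self r W)]
    have h := congrArg (fun f : SetFunction V R => f (insert r W)) (hrec r m hmr)
    simp only [mark_apply, Finset.mem_insert_of_mem hm, if_true, mul_apply] at h
    rw [h, Finset.sum_powerset_insert hr]
    -- If `r` goes into the first block, the second misses `r`, where `c r` vanishes.
    have hz : ∑ t ∈ W.powerset, (twist (x r) (c m) - c m) (insert r t) *
        c r (insert r W \ insert r t) = 0 :=
      Finset.sum_eq_zero fun B _ => by rw [hsupp r _ (by simp), mul_zero]
    rw [hz, add_zero]
    refine Finset.sum_congr rfl fun B hB => ?_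
    have hrB : r ∉ B := fun h => hr (Finset.mem_powerset.1 hB h)
    rw [Finset.insert_sdiff_of_notMem _ hrB, sub_apply, twist_apply]
    split_ifs with hmB
    · rw [hC _ r (Finset.mem_insert_self _ _), hC B m hmB]
      ring
    · rw [hsupp m B hmB]; ring

end SetFunction

/-! ### Trees as parent maps; grafting and cutting branches. -/

/-- `Reaches p a b` says that iterating `p` leads from `a` to `b`. -/
abbrev Reaches {V : Type*} (p : V → V) : V → V → Prop :=
  Relation.ReflTransGen (fun a b => p a = b)

namespace Reaches

variable {V : Type*} {p p' : V → V} {a b r : V}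

theorem step (p : V → V) (a : V) : Reaches p a (p a) := Relation.ReflTransGen.single rfl

theorem eq_of_fixed (hr : p a = a) (h : Reaches p a b) : b = a := by
  induction h with
  | refl => rfl
  | tail _ hbc ih => rw [← hbc, ih, hr]

theorem mem_of_closed {S : V → Prop} (hS : ∀ a, S a → S (p a)) (h : Reaches p a b) (ha : S a) :
    S b := by
  induction h with
  | refl => exact ha
  | tail _ hbc ih => rw [← hbc]; exact hS _ ih

theorem congr_of_closed {S : V → Prop} (hS : ∀ a, S a → S (p a)) (hp : ∀ a, S a → p a = p' a)
    (h : Reaches p a b) (ha : S a) : Reaches p' a b := by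
  induction h using Relation.ReflTransGen.head_induction_on with
  | refl => exact .refl
  | head hab _ ih =>
    subst hab
    exact .head (hp _ ha).symm (ih (hS _ ha))

theorem total {c : V} (hab : Reaches p a b) (hac : Reaches p a c) :
    Reaches p b c ∨ Reaches p c b :=
  Relation.ReflTransGen.total_of_right_unique (fun _ _ _ h h' => h.symm.trans h') hab hac

/-- A vertex that reaches a fixed point is not on a cycle. -/
theorem antisymm_of_fixed (hr : p r = r) (h : Reaches p a r) (hab : Reaches p (p a) a) : a = r := by
  have hS : ∀ b, Reaches p b a → Reaches p (p b) a := by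
    intro b hb
    rcases hb.cases_head with rfl | ⟨c, rfl, hc⟩
    · exact hab
    · exact hc
  exact eq_of_fixed hr (mem_of_closed (S := fun b => Reaches p b a) hS h .refl)

end Reaches

/-- `p` is the parent map of a tree on `W ∪ {r}` rooted at `r`, extended by the identity. -/
structure IsTreeMap {V : Type*} (r : V) (W : Finset V) (p : V → V) : Prop where
  fixed : ∀ i ∉ W, p i = i
  reaches : ∀ i ∈ W, Reaches p i r

/-- The parent map of the tree obtained by joining the tree `p₁` on `B`, rooted at `v`, to the
vertex `r` of the tree `p₂`. -/
def graft {V : Type*} [DecidableEq V] (r : V) (B : Finset V) (v : V) (p₁ p₂ : V → V) (i : V) : V :=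
  if i = v then r else if i ∈ B then p₁ i else p₂ i

namespace IsTreeMap

variable {V : Type*} [DecidableEq V] {r v m : V} {W B : Finset V} {p p₁ p₂ : V → V}

theorem map_mem (hp : IsTreeMap r W p) (hr : r ∉ W) {i : V} (hi : i ∈ W) : p i = r ∨ p i ∈ W := by
  by_cases h : p i ∈ W
  · exact .inr h
  · left
    rcases (hp.reaches i hi).cases_head with rfl | ⟨c, rfl, hc⟩
    · exact absurd hi hr
    · exact (Reaches.eq_of_fixed (hp.fixed _ h) hc).symm

section Graft

variable (hB : B ⊆ W) (hv : v ∈ B) (hr : r ∉ W) (h₁ : IsTreeMap v (B.erase v) p₁)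
  (h₂ : IsTreeMap r (W \ B) p₂)

include hv in
theorem graft_of_notMem {i : V} (hi : i ∉ B) : graft r B v p₁ p₂ i = p₂ i := by
  have : i ≠ v := fun h => hi (h ▸ hv)
  simp [graft, this, hi]

theorem graft_of_mem_erase {i : V} (hi : i ∈ B.erase v) : graft r B v p₁ p₂ i = p₁ i := by
  simp [graft, Finset.ne_of_mem_erase hi, Finset.mem_of_mem_erase hi]

theorem graft_top : graft r B v p₁ p₂ v = r := by simp [graft]

include hB hr h₂ in
theorem map_notMem {i : V} (hi : i ∉ B) : p₂ i ∉ B := by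
  intro h
  by_cases hW : i ∈ W \ B
  · rcases h₂.map_mem (fun h => hr (Finset.mem_sdiff.1 h).1) hW with h' | h'
    · exact hr (hB (h' ▸ h))
    · exact (Finset.mem_sdiff.1 h').2 h
  · rw [h₂.fixed i hW] at h
    exact hi h

include hv h₁ in
theorem map_mem_branch {i : V} (hi : i ∈ B.erase v) : p₁ i ∈ B := by
  rcases h₁.map_mem (Finset.notMem_erase v B) hi with h' | h'
  · exact h' ▸ hv
  · exact Finset.mem_of_mem_erase h'

-- The complement of `B` is closed under `p₂`, and there the graft agrees with `p₂`.
include hB hr h₂ hv in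
theorem reaches_graft_iff_of_notMem {i j : V} (hj : j ∉ B) :
    Reaches (graft r B v p₁ p₂) j i ↔ Reaches p₂ j i := by
  have hcl : ∀ a, a ∉ B → p₂ a ∉ B := fun a => map_notMem hB hr h₂
  constructor
  · intro h
    refine Reaches.congr_of_closed (S := (· ∉ B)) (fun a ha => ?_)
      (fun a ha => graft_of_notMem hv ha) h hj
    rw [graft_of_notMem hv ha]
    exact hcl a ha
  · intro h
    exact Reaches.congr_of_closed (S := (· ∉ B)) hcl
      (fun a ha => (graft_of_notMem hv ha).symm) h hj

include hB hr h₂ hv in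
theorem not_reaches_graft {i j : V} (hj : j ∉ B) (hi : i ∈ B) :
    ¬ Reaches (graft r B v p₁ p₂) j i := by
  rw [reaches_graft_iff_of_notMem hB hv hr h₂ hj]
  exact fun h => Reaches.mem_of_closed (S := (· ∉ B)) (fun a => map_notMem hB hr h₂) h hj hi

include hB hr h₂ hv in
theorem graft_root : graft r B v p₁ p₂ r = r := by
  rw [graft_of_notMem hv fun h => hr (hB h), h₂.fixed]
  exact fun h => hr (Finset.mem_sdiff.1 h).1

include hv h₁ in
theorem reaches_graft_of_reaches {i j : V} (h : Reaches p₁ j i) (hj : j ∈ B) :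
    Reaches (graft r B v p₁ p₂) j i := by
  induction h using Relation.ReflTransGen.head_induction_on with
  | refl => exact .refl
  | @head a c hac _ ih =>
    subst hac
    by_cases ha : a = v
    · have hpa : p₁ a = a := h₁.fixed _ (by simp [ha])
      rw [hpa] at ih
      exact ih hj
    · have haB := Finset.mem_erase.2 ⟨ha, hj⟩
      exact .head (graft_of_mem_erase haB) (ih (map_mem_branch hv h₁ haB))

include hB hr hv h₁ h₂ in
theorem reaches_of_reaches_graft {i j : V} (hiW : i ≠ r) (h : Reaches (graft r B v p₁ p₂) j i)
    (hj : j ∈ B) : Reaches p₁ j i := by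
  induction h using Relation.ReflTransGen.head_induction_on with
  | refl => exact .refl
  | @head a c hac h ih =>
    -- The only exit from `B` is the step from `v` to `r`, where the path stays; the target is not
    -- `r`.
    by_cases ha : a = v
    · subst ha
      rw [graft_top] at hac
      subst hac
      exact absurd (Reaches.eq_of_fixed (graft_root hB hv hr h₂) h) hiW
    · have haB := Finset.mem_erase.2 ⟨ha, hj⟩
      rw [graft_of_mem_erase haB] at hac
      subst hac
      exact .head rfl (ih (map_mem_branch hv h₁ haB))

-- This and the next two lemmas compute the descendants of each vertex of the graft: all of `B` for
-- `v`, and those of the relevant piece for every other vertex. The edge factors depend on nothing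
-- else but parents.
include hB hr hv h₁ h₂ in
theorem reaches_graft_top {j : V} : Reaches (graft r B v p₁ p₂) j v ↔ j ∈ B := by
  constructor
  · intro h
    by_contra hj
    exact not_reaches_graft hB hv hr h₂ hj hv h
  · intro hj
    refine reaches_graft_of_reaches hv h₁ ?_ hj
    by_cases h : j = v
    · rw [h]
    · exact h₁.reaches j (Finset.mem_erase.2 ⟨h, hj⟩)

include hB hr hv h₁ h₂ in
theorem reaches_graft_branch {i j : V} (hi : i ∈ B.erase v) :
    Reaches (graft r B v p₁ p₂) j i ↔ j ∈ B.erase v ∧ Reaches p₁ j i := by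
  have hiB := Finset.mem_of_mem_erase hi
  constructor
  · intro h
    have hj : j ∈ B := by
      by_contra hj
      exact not_reaches_graft hB hv hr h₂ hj hiB h
    have h' := reaches_of_reaches_graft hB hv hr h₁ h₂ (fun h => hr (hB (h ▸ hiB))) h hj
    refine ⟨Finset.mem_erase.2 ⟨?_, hj⟩, h'⟩
    rintro rfl
    exact Finset.ne_of_mem_erase hi (Reaches.eq_of_fixed (h₁.fixed _ (Finset.notMem_erase _ _)) h')
  · rintro ⟨hj, h⟩
    exact reaches_graft_of_reaches hv h₁ h (Finset.mem_of_mem_erase hj)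

include hB hr hv h₁ h₂ in
theorem reaches_graft_rest {i j : V} (hi : i ∈ W \ B) :
    Reaches (graft r B v p₁ p₂) j i ↔ j ∉ B ∧ Reaches p₂ j i := by
  obtain ⟨hiW, hiB⟩ := Finset.mem_sdiff.1 hi
  by_cases hj : j ∈ B
  · simp only [hj, not_true, false_and, iff_false]
    intro h
    have h' := reaches_of_reaches_graft hB hv hr h₁ h₂ (fun h => hr (h ▸ hiW)) h hj
    refine hiB (Reaches.mem_of_closed (S := (· ∈ B)) (fun a ha => ?_) h' hj)
    by_cases hav : a = v
    · rwa [h₁.fixed a (by simp [hav])]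
    · exact map_mem_branch hv h₁ (Finset.mem_erase.2 ⟨hav, ha⟩)
  · simp only [hj, not_false_eq_true, true_and]
    exact reaches_graft_iff_of_notMem hB hv hr h₂ hj

include hB hr hv h₁ h₂ in
theorem isTreeMap_graft : IsTreeMap r W (graft r B v p₁ p₂) where
  fixed i hi := by
    rw [graft_of_notMem hv fun h => hi (hB h), h₂.fixed i fun h => hi (Finset.mem_sdiff.1 h).1]
  reaches i hi := by
    by_cases hiB : i ∈ B
    · exact ((reaches_graft_top hB hv hr h₁ h₂).2 hiB).tail graft_top
    · exact (reaches_graft_iff_of_notMem hB hv hr h₂ hiB).2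
        (h₂.reaches i (Finset.mem_sdiff.2 ⟨hi, hiB⟩))

end Graft

theorem map_root (hp : IsTreeMap r W p) (hr : r ∉ W) : p r = r := hp.fixed r hr

theorem exists_top (hp : IsTreeMap r W p) (hr : r ∉ W) (hm : m ∈ W) :
    ∃ v ∈ W, Reaches p m v ∧ p v = r := by
  have key : ∀ j, Reaches p j r → j ∈ W → ∃ v ∈ W, Reaches p j v ∧ p v = r := by
    intro j h
    induction h using Relation.ReflTransGen.head_induction_on with
    | refl => exact fun h => absurd h hr
    | @head a c hac _ ih =>
      intro ha
      subst hac
      rcases hp.map_mem hr ha with h | h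
      · exact ⟨a, ha, .refl, h⟩
      · obtain ⟨v, hv, h1, h2⟩ := ih h
        exact ⟨v, hv, .head rfl h1, h2⟩
  exact key m (hp.reaches m hm) hm

theorem top_unique (hp : IsTreeMap r W p) (hr : r ∉ W) {v' : V} (hvW : v ∈ W) (hvW' : v' ∈ W)
    (h : Reaches p m v) (h' : Reaches p m v') (hv : p v = r) (hv' : p v' = r) : v = v' := by
  have key : ∀ a b, a ∈ W → b ∈ W → p a = r → Reaches p a b → a = b := by
    intro a b _ hb ha hab
    rcases hab.cases_head with h | ⟨c, rfl, hc⟩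
    · exact h
    · rw [ha] at hc
      exact absurd (Reaches.eq_of_fixed (hp.map_root hr) hc ▸ hb) hr
  rcases Reaches.total h h' with h | h
  · exact key _ _ hvW hvW' hv h
  · exact (key _ _ hvW' hvW hv' h).symm

-- Inverse of grafting: `v` is the child of `r` on the path from `m`, and `B` is the set of its
-- descendants.
open Classical in
theorem exists_graft (hp : IsTreeMap r W p) (hr : r ∉ W) (hm : m ∈ W) :
    ∃ B v p₁ p₂, B ⊆ W ∧ m ∈ B ∧ v ∈ B ∧ IsTreeMap v (B.erase v) p₁ ∧ IsTreeMap r (W \ B) p₂ ∧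
      graft r B v p₁ p₂ = p := by
  obtain ⟨v, hvW, hmv, hv⟩ := hp.exists_top hr hm
  have hB : ∀ i, i ∈ W.filter (fun j => Reaches p j v) ↔ i ∈ W ∧ Reaches p i v := by simp
  set B := W.filter (fun j => Reaches p j v)
  have hvB : v ∈ B := (hB v).2 ⟨hvW, .refl⟩
  refine ⟨B, v, fun i => if i ∈ B.erase v then p i else i, fun i => if i ∈ W \ B then p i else i,
    Finset.filter_subset _ _, (hB m).2 ⟨hm, hmv⟩, hvB, ⟨?_, ?_⟩, ⟨?_, ?_⟩, ?_⟩
  · intro i hi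
    simp only [if_neg hi]
  · intro i hi
    have h := ((hB i).1 (Finset.mem_of_mem_erase hi)).2
    clear hi
    induction h using Relation.ReflTransGen.head_induction_on with
    | refl => exact .refl
    | @head a c hac h ih =>
      subst hac
      by_cases hav : a = v
      · rw [hav]
      by_cases ha : a ∈ W
      · exact .head (if_pos (Finset.mem_erase.2 ⟨hav, (hB a).2 ⟨ha, .head rfl h⟩⟩)) ih
      · rwa [hp.fixed a ha] at ih
  · intro i hi
    simp only [if_neg hi]
  · intro i hi
    obtain ⟨hiW, hiB⟩ := Finset.mem_sdiff.1 hi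
    have h := hp.reaches i hiW
    have hiv : ¬ Reaches p i v := fun h => hiB ((hB i).2 ⟨hiW, h⟩)
    clear hi hiB hiW
    induction h using Relation.ReflTransGen.head_induction_on with
    | refl => exact .refl
    | @head a c hac h ih =>
      subst hac
      have hiv' : ¬ Reaches p (p a) v := fun h => hiv (.head rfl h)
      by_cases ha : a ∈ W
      · exact .head (if_pos (Finset.mem_sdiff.2 ⟨ha, fun h => hiv ((hB a).1 h).2⟩)) (ih hiv')
      · rw [hp.fixed a ha] at ih
        exact ih hiv
  · funext i
    by_cases hiv : i = v
    · simp [graft, hiv, hv]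
    by_cases hiB : i ∈ B
    · simp [graft, hiv, hiB]
    by_cases hiW : i ∈ W
    · simp [graft, hiv, hiB, hiW]
    · simp [graft, hiv, hiB, hiW, hp.fixed]

end IsTreeMap

/-! ### The tree sum and its recursion. -/

section TreeSum

variable {V α R : Type*} [Fintype V] [DecidableEq V] [LinearOrder α] [CommRing R]

open Classical in
/-- The parent maps of trees on `W ∪ {r}` rooted at `r`. -/
def treeMaps (r : V) (W : Finset V) : Finset (V → V) := {p | IsTreeMap r W p}

theorem mem_treeMaps {r : V} {W : Finset V} {p : V → V} : p ∈ treeMaps r W ↔ IsTreeMap r W p := by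
  simp [treeMaps]

open Classical in
/-- The contribution of the edge from `i` to its parent. -/
def edgeFactor (ω : Sym2 V → ℕ) (f : V → α) (q : R) (W : Finset V) (p : V → V) (i : V) : R :=
  (q ^ ω s(p i, i) - 1) * q ^ ∑ j ∈ W with f j < f i ∧ Reaches p j i, ω s(p i, j)

/-- The weighted sum over all trees on `W ∪ {r}` rooted at `r`. -/
def treeSum (ω : Sym2 V → ℕ) (f : V → α) (q : R) (r : V) (W : Finset V) : R :=
  ∑ p ∈ treeMaps r W, ∏ i ∈ W, edgeFactor ω f q W p i

theorem edgeFactor_congr (ω : Sym2 V → ℕ) (f : V → α) (q : R) {W W' : Finset V} {p p' : V → V}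
    {i : V} (hi : p i = p' i)
    (h : ∀ j, j ∈ W ∧ Reaches p j i ↔ j ∈ W' ∧ Reaches p' j i) :
    edgeFactor ω f q W p i = edgeFactor ω f q W' p' i := by
  unfold edgeFactor
  rw [hi]
  congr 3
  ext j
  have := h j
  simp only [Finset.mem_filter]
  tauto

theorem prod_edgeFactor_graft (ω : Sym2 V → ℕ) (f : V → α) (q : R) {r v : V} {W B : Finset V}
    {p₁ p₂ : V → V} (hB : B ⊆ W) (hv : v ∈ B) (hr : r ∉ W) (h₁ : IsTreeMap v (B.erase v) p₁)
    (h₂ : IsTreeMap r (W \ B) p₂) :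
    ∏ i ∈ W, edgeFactor ω f q W (graft r B v p₁ p₂) i =
      ((q ^ ω s(r, v) - 1) * q ^ ∑ j ∈ B with f j < f v, ω s(r, j)) *
        (∏ i ∈ B.erase v, edgeFactor ω f q (B.erase v) p₁ i) *
        ∏ i ∈ W \ B, edgeFactor ω f q (W \ B) p₂ i := by
  rw [← Finset.prod_sdiff hB, ← Finset.mul_prod_erase B _ hv, mul_comm]
  congr 1
  · congr 1
    · unfold edgeFactor
      rw [IsTreeMap.graft_top]
      congr 3
      ext j
      simp only [Finset.mem_filter, IsTreeMap.reaches_graft_top hB hv hr h₁ h₂]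
      have := @hB j
      tauto
    · refine Finset.prod_congr rfl fun i hi =>
        edgeFactor_congr ω f q (IsTreeMap.graft_of_mem_erase hi) fun j => ?_
      rw [IsTreeMap.reaches_graft_branch hB hv hr h₁ h₂ hi]
      have : j ∈ B.erase v → j ∈ W := fun h => hB (Finset.mem_of_mem_erase h)
      tauto
  · refine Finset.prod_congr rfl fun i hi => edgeFactor_congr ω f q
      (IsTreeMap.graft_of_notMem hv (Finset.mem_sdiff.1 hi).2) fun j => ?_
    rw [IsTreeMap.reaches_graft_rest hB hv hr h₁ h₂ hi, Finset.mem_sdiff]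
    tauto

/-- Grafting is a bijection from pairs of trees, with a choice of branch `B ∋ m` and of its top `v`,
to trees on `W ∪ {r}`; `prod_edgeFactor_graft` makes it multiplicative on weights. -/
theorem treeSum_eq_sum_branch (ω : Sym2 V → ℕ) (f : V → α) (q : R) {r m : V} {W : Finset V}
    (hr : r ∉ W) (hm : m ∈ W) :
    treeSum ω f q r W = ∑ B ∈ W.powerset, if m ∈ B then
      (∑ v ∈ B, ((q ^ ω s(r, v) - 1) * q ^ ∑ j ∈ B with f j < f v, ω s(r, j)) *
        treeSum ω f q v (B.erase v)) * treeSum ω f q r (W \ B) else 0 := by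
  rw [← Finset.sum_filter]
  simp only [treeSum, Finset.mul_sum, Finset.sum_mul]
  rw [Finset.sum_sigma', Finset.sum_sigma', Finset.sum_sigma']
  symm
  refine Finset.sum_bij (fun x _ => graft r x.1.1.1 x.1.2 x.2 x.1.1.2) ?_ ?_ ?_ ?_
  · rintro ⟨⟨⟨B, p₂⟩, v⟩, p₁⟩ hx
    simp only [Finset.mem_sigma, Finset.mem_filter, Finset.mem_powerset, mem_treeMaps] at hx ⊢
    obtain ⟨⟨⟨⟨hB, hmB⟩, h₂⟩, hv⟩, h₁⟩ := hx
    exact IsTreeMap.isTreeMap_graft hB hv hr h₁ h₂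
  · rintro ⟨⟨⟨B, p₂⟩, v⟩, p₁⟩ hx ⟨⟨⟨B', p₂'⟩, v'⟩, p₁'⟩ hx' heq
    simp only [Finset.mem_sigma, Finset.mem_filter, Finset.mem_powerset, mem_treeMaps]
      at hx hx' heq
    obtain ⟨⟨⟨⟨hB, hmB⟩, h₂⟩, hv⟩, h₁⟩ := hx
    obtain ⟨⟨⟨⟨hB', hmB'⟩, h₂'⟩, hv'⟩, h₁'⟩ := hx'
    have htop := fun j => IsTreeMap.reaches_graft_top (j := j) hB hv hr h₁ h₂
    have htop' := fun j => IsTreeMap.reaches_graft_top (j := j) hB' hv' hr h₁' h₂'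
    -- The grafted map determines `v` as the child of `r` above `m`, then `B` as the descendants of
    -- `v`.
    have hv_eq : v = v' := by
      refine IsTreeMap.top_unique (IsTreeMap.isTreeMap_graft hB hv hr h₁ h₂) hr (hB hv) (hB' hv')
        ((htop m).2 hmB) ?_ IsTreeMap.graft_top ?_
      · rw [heq]; exact (htop' m).2 hmB'
      · rw [heq]; exact IsTreeMap.graft_top
    subst hv_eq
    have hB_eq : B = B' := by
      ext j
      rw [← htop j, ← htop' j, heq]
    subst hB_eq
    have h₁_eq : p₁ = p₁' := by
      funext i
      by_cases hi : i ∈ B.erase v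
      · rw [← IsTreeMap.graft_of_mem_erase (r := r) (p₁ := p₁) (p₂ := p₂) hi, heq,
          IsTreeMap.graft_of_mem_erase hi]
      · rw [h₁.fixed i hi, h₁'.fixed i hi]
    have h₂_eq : p₂ = p₂' := by
      funext i
      by_cases hi : i ∈ B
      · rw [h₂.fixed i (by simp [hi]), h₂'.fixed i (by simp [hi])]
      · rw [← IsTreeMap.graft_of_notMem (r := r) (p₁ := p₁) (p₂ := p₂) hv hi, heq,
          IsTreeMap.graft_of_notMem hv hi]
    rw [h₁_eq, h₂_eq]
  · intro p hp
    obtain ⟨B, v, p₁, p₂, hB, hmB, hv, h₁, h₂, rfl⟩ :=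
      (mem_treeMaps.1 hp).exists_graft hr hm
    refine ⟨⟨⟨⟨B, p₂⟩, v⟩, p₁⟩, ?_, rfl⟩
    simp only [Finset.mem_sigma, Finset.mem_filter, Finset.mem_powerset, mem_treeMaps]
    exact ⟨⟨⟨⟨hB, hmB⟩, h₂⟩, hv⟩, h₁⟩
  · rintro ⟨⟨⟨B, p₂⟩, v⟩, p₁⟩ hx
    simp only [Finset.mem_sigma, Finset.mem_filter, Finset.mem_powerset, mem_treeMaps] at hx ⊢
    obtain ⟨⟨⟨⟨hB, hmB⟩, h₂⟩, hv⟩, h₁⟩ := hx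
    exact (prod_edgeFactor_graft ω f q hB hv hr h₁ h₂).symm

theorem treeSum_empty (ω : Sym2 V → ℕ) (f : V → α) (q : R) (r : V) :
    treeSum ω f q r ∅ = 1 := by
  have : treeMaps r (∅ : Finset V) = {id} := by
    ext p
    rw [mem_treeMaps, Finset.mem_singleton]
    constructor
    · exact fun h => funext fun i => h.fixed i (Finset.notMem_empty i)
    · rintro rfl
      exact ⟨fun _ _ => rfl, fun i hi => absurd hi (Finset.notMem_empty i)⟩
  simp [treeSum, this]

/-- In increasing order of `f`, each term is `q` to the partial sum through `v` minus `q` to the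
partial sum before `v`. Injectivity of `f` excludes ties. -/
theorem sum_telescope {f : V → α} (hf : Function.Injective f) (q : R) (x : V → ℕ) (B : Finset V) :
    ∑ v ∈ B, (q ^ x v - 1) * q ^ ∑ j ∈ B with f j < f v, x j = q ^ (∑ j ∈ B, x j) - 1 := by
  induction B using Finset.induction_on_max_value f with
  | empty => simp
  | insert a s ha hmax ih =>
    have hlt : ∀ j ∈ s, f j < f a := fun j hj =>
      lt_of_le_of_ne (hmax j hj) fun h => ha (hf h ▸ hj)
    rw [Finset.sum_insert ha, Finset.sum_insert ha]
    have h1 : (insert a s).filter (fun j => f j < f a) = s := by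
      ext j
      simp only [Finset.mem_filter, Finset.mem_insert]
      constructor
      · rintro ⟨rfl | h, h'⟩
        · exact absurd h' (lt_irrefl _)
        · exact h
      · exact fun h => ⟨.inr h, hlt j h⟩
    have h2 : ∀ v ∈ s, (insert a s).filter (fun j => f j < f v) = s.filter (fun j => f j < f v) :=
      fun v hv => by rw [Finset.filter_insert, if_neg (hlt v hv).not_gt]
    have h3 : ∑ v ∈ s, (q ^ x v - 1) * q ^ ∑ j ∈ insert a s with f j < f v, x j =
        ∑ v ∈ s, (q ^ x v - 1) * q ^ ∑ j ∈ s with f j < f v, x j :=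
      Finset.sum_congr rfl fun v hv => by rw [h2 v hv]
    rw [h1, h3, ih, pow_add]
    ring

/-- By induction the tree sum of a branch is `C B` whatever its root `v`, so it factors out of the
sum over `v` and the rest telescopes. This is where the order disappears. -/
theorem treeSum_eq_of_recursion (ω : Sym2 V → ℕ) {f : V → α} (hf : Function.Injective f) (q : R)
    {C : Finset V → R} (h1 : ∀ r, C {r} = 1)
    (hC : ∀ r m W, r ∉ W → m ∈ W → C (insert r W) = ∑ B ∈ W.powerset,
      if m ∈ B then (∏ j ∈ B, q ^ ω s(r, j) - 1) * C B * C (insert r (W \ B)) else 0)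
    (r : V) (W : Finset V) (hr : r ∉ W) : treeSum ω f q r W = C (insert r W) := by
  induction hn : W.card using Nat.strong_induction_on generalizing r W with
  | _ n ih =>
    subst hn
    rcases W.eq_empty_or_nonempty with rfl | ⟨m, hm⟩
    · rw [treeSum_empty, insert_empty_eq, h1]
    rw [treeSum_eq_sum_branch ω f q hr hm, hC r m W hr hm]
    refine Finset.sum_congr rfl fun B hB => ?_
    rw [Finset.mem_powerset] at hB
    split_ifs with hmB
    · have hlt : (W \ B).card < W.card :=
        Finset.card_lt_card (Finset.sdiff_ssubset hB ⟨m, hmB⟩)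
      rw [ih _ hlt r _ (fun h => hr (Finset.mem_sdiff.1 h).1) rfl]
      have : ∀ v ∈ B, treeSum ω f q v (B.erase v) = C B := fun v hv => by
        rw [ih _ ((Finset.card_erase_lt_of_mem hv).trans_le (Finset.card_le_card hB)) v _
          (Finset.notMem_erase v B) rfl, Finset.insert_erase hv]
      rw [Finset.sum_congr rfl fun v hv => by rw [this v hv], ← Finset.sum_mul,
        sum_telescope hf q (fun j => ω s(r, j)), Finset.prod_pow_eq_pow_sum]
    · rfl

end TreeSum

/-! ### Edge counts of induced subgraphs. -/

section EdgesIn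

variable {V R : Type*} [DecidableEq V] [CommRing R] {ω : Sym2 V → ℕ}

/-- The number of edges inside `X`, counted with multiplicity. -/
def edgesIn (ω : Sym2 V → ℕ) (X : Finset V) : ℕ := ∑ e ∈ X.sym2, ω e

theorem edgesIn_empty (ω : Sym2 V → ℕ) : edgesIn ω ∅ = 0 := by simp [edgesIn]

theorem edgesIn_insert (hω : ∀ v, ω s(v, v) = 0) {r : V} {X : Finset V} (hr : r ∉ X) :
    edgesIn ω (insert r X) = edgesIn ω X + ∑ j ∈ X, ω s(r, j) := by
  unfold edgesIn
  rw [Finset.sym2_insert, Finset.sum_union, add_comm, Finset.sum_image, Finset.sum_insert hr, hω,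
    zero_add]
  · intro a _ b _ h
    exact Sym2.congr_right.1 h
  · rw [Finset.disjoint_left]
    intro e he he'
    obtain ⟨j, _, rfl⟩ := Finset.mem_image.1 he
    exact hr (Finset.mk_mem_sym2_iff.1 he').1

theorem edgesIn_union (hω : ∀ v, ω s(v, v) = 0) {X U : Finset V} (h : Disjoint X U) :
    edgesIn ω (X ∪ U) = edgesIn ω X + edgesIn ω U + ∑ i ∈ U, ∑ j ∈ X, ω s(i, j) := by
  induction U using Finset.induction_on with
  | empty => simp [edgesIn_empty]
  | insert a U ha ih =>
    rw [Finset.disjoint_insert_right] at h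
    have haX : a ∉ X ∪ U := by simp [h.1, ha]
    rw [Finset.union_insert, edgesIn_insert hω haX, ih h.2, edgesIn_insert hω ha,
      Finset.sum_insert ha, Finset.sum_union h.2]
    ring

theorem mark_pow_edgesIn (hω : ∀ v, ω s(v, v) = 0) (q : R) (r : V) :
    SetFunction.mark r ⟨fun X => q ^ edgesIn ω X⟩ =
      SetFunction.atom r * SetFunction.twist (fun j => q ^ ω s(r, j)) ⟨fun X => q ^ edgesIn ω X⟩ := by
  refine SetFunction.ext_apply fun X => ?_
  rw [SetFunction.atom_mul_apply, SetFunction.mark_apply]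
  split_ifs with h
  · rw [SetFunction.twist_apply, Finset.prod_pow_eq_pow_sum, ← pow_add, add_comm,
      ← edgesIn_insert hω (Finset.notMem_erase r X), Finset.insert_erase h]
  · rfl

end EdgesIn

/-! ### The parking function side and its comparison with the tree sum. -/

section ParkingSum

variable {V R : Type*} [Fintype V] [DecidableEq V] [CommRing R] {ω : Sym2 V → ℕ}

/-- Parking functions of the induced multigraph on `S ∪ {r}`. -/
def IsParkingOn (ω : Sym2 V → ℕ) (r : V) (S : Finset V) (α : V → ℕ) : Prop :=
  ∀ U ⊆ S, U.Nonempty → ∃ i ∈ U, α i < ∑ j ∈ insert r (S \ U), ω s(i, j)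

/-- Every vertex of `U` has a value that is at least its number of edges leaving `U` inside
`W ∪ {r}`. -/
def IsBlocked (ω : Sym2 V → ℕ) (r : V) (W U : Finset V) (α : V → ℕ) : Prop :=
  ∀ i ∈ U, ∑ j ∈ insert r (W \ U), ω s(i, j) ≤ α i

theorem IsParkingOn.congr {r : V} {S : Finset V} {α β : V → ℕ} (h : IsParkingOn ω r S α)
    (hαβ : ∀ i ∈ S, α i = β i) : IsParkingOn ω r S β := by
  intro U hU hne
  obtain ⟨i, hi, h⟩ := h U hU hne
  exact ⟨i, hi, hαβ i (hU hi) ▸ h⟩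

/-- Otherwise parking at `U' \ U` provides a vertex whose value is below its number of edges to `r`
and `W \ (U ∪ U')`, hence below its number of edges leaving `U'`. So the `U` of the next lemma is
the largest blocked set, hence unique. -/
theorem IsBlocked.subset_of_isParkingOn {r : V} {W U U' : Finset V} {α : V → ℕ}
    (hp : IsParkingOn ω r (W \ U) α) (hU' : U' ⊆ W) (hb : IsBlocked ω r W U' α) : U' ⊆ U := by
  rw [← Finset.sdiff_eq_empty_iff_subset]
  by_contra hne
  obtain ⟨i, hi, hlt⟩ := hp (U' \ U) (Finset.sdiff_subset_sdiff hU' le_rfl)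
    (Finset.nonempty_iff_ne_empty.2 hne)
  refine absurd (hb i (Finset.mem_sdiff.1 hi).1) (not_le.2 (hlt.trans_le ?_))
  refine Finset.sum_le_sum_of_subset (Finset.insert_subset_insert r ?_)
  intro j hj
  simp only [Finset.mem_sdiff] at hj ⊢
  tauto

/-- Take a blocked set of maximal size: a set violating the parking condition on the rest could be
added to it. -/
theorem exists_isBlocked_isParkingOn (ω : Sym2 V → ℕ) (r : V) (W : Finset V) (α : V → ℕ) :
    ∃ U ⊆ W, IsParkingOn ω r (W \ U) α ∧ IsBlocked ω r W U α := by
  classical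
  obtain ⟨U, hU, hmax⟩ := Finset.exists_max_image (W.powerset.filter (IsBlocked ω r W · α))
    Finset.card ⟨∅, Finset.mem_filter.2 ⟨Finset.empty_mem_powerset W, fun i hi =>
      absurd hi (Finset.notMem_empty i)⟩⟩
  simp only [Finset.mem_filter, Finset.mem_powerset] at hU hmax
  refine ⟨U, hU.1, ?_, hU.2⟩
  intro U' hU' hne
  by_contra! hcon
  have hdisj : Disjoint U U' := (Finset.subset_sdiff.1 hU').2.symm
  have hb : IsBlocked ω r W (U ∪ U') α := by
    intro i hi
    rcases Finset.mem_union.1 hi with hi | hi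
    · refine le_trans (Finset.sum_le_sum_of_subset (Finset.insert_subset_insert r ?_)) (hU.2 i hi)
      exact Finset.sdiff_subset_sdiff le_rfl Finset.subset_union_left
    · have h := hcon i hi
      rwa [sdiff_sdiff_left] at h
  have := hmax (U ∪ U') ⟨Finset.union_subset hU.1 (hU'.trans Finset.sdiff_subset), hb⟩
  rw [Finset.card_union_of_disjoint hdisj] at this
  have := hne.card_pos
  omega

/-- Functions that vanish outside `U` and take values in the intervals `[d i, N)` on `U`. -/
def boxMaps (U : Finset V) (d : V → ℕ) (N : ℕ) : Finset (V → ℕ) :=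
  Fintype.piFinset fun i => if i ∈ U then Finset.Ico (d i) N else {0}

theorem mem_boxMaps {U : Finset V} {d : V → ℕ} {N : ℕ} {α : V → ℕ} :
    α ∈ boxMaps U d N ↔ (∀ i ∈ U, d i ≤ α i ∧ α i < N) ∧ ∀ i ∉ U, α i = 0 := by
  simp only [boxMaps, Fintype.mem_piFinset, ← forall_and]
  refine forall_congr' fun i => ?_
  split_ifs with h <;> simp [h]

theorem sum_boxMaps (t : R) (U : Finset V) (d : V → ℕ) (N : ℕ) :
    ∑ α ∈ boxMaps U d N, ∏ i, t ^ α i = ∏ i ∈ U, ∑ a ∈ Finset.Ico (d i) N, t ^ a := by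
  rw [boxMaps, ← Finset.prod_univ_sum, ← Finset.prod_subset (Finset.subset_univ U)]
  · exact Finset.prod_congr rfl fun i hi => by rw [if_pos hi]
  · intro i _ hi
    simp [hi]

/-- A bound for all vertex degrees. -/
def degreeBound (ω : Sym2 V → ℕ) : ℕ := ∑ i, ∑ j, ω s(i, j)

theorem sum_le_degreeBound (i : V) (X : Finset V) : ∑ j ∈ X, ω s(i, j) ≤ degreeBound ω :=
  (Finset.sum_le_sum_of_subset (Finset.subset_univ X)).trans
    (Finset.single_le_sum (f := fun i => ∑ j, ω s(i, j)) (fun _ _ => Nat.zero_le _)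
      (Finset.mem_univ i))

open Classical in
/-- The parking functions on `S ∪ {r}`, extended by zero. -/
def parkingMaps (ω : Sym2 V → ℕ) (r : V) (S : Finset V) : Finset (V → ℕ) :=
  (boxMaps S 0 (degreeBound ω)).filter (IsParkingOn ω r S)

theorem IsParkingOn.lt {r : V} {S : Finset V} {α : V → ℕ} (h : IsParkingOn ω r S α) {i : V}
    (hi : i ∈ S) : α i < degreeBound ω := by
  obtain ⟨j, hj, hlt⟩ := h {i} (Finset.singleton_subset_iff.2 hi) (Finset.singleton_nonempty i)
  rw [Finset.mem_singleton] at hj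
  subst hj
  exact hlt.trans_le (sum_le_degreeBound _ _)

theorem mem_parkingMaps {r : V} {S : Finset V} {α : V → ℕ} :
    α ∈ parkingMaps ω r S ↔ (∀ i ∉ S, α i = 0) ∧ IsParkingOn ω r S α := by
  simp only [parkingMaps, Finset.mem_filter, mem_boxMaps]
  constructor
  · exact fun h => ⟨h.1.2, h.2⟩
  · exact fun h => ⟨⟨fun i hi => ⟨Nat.zero_le _, h.2.lt hi⟩, h.1⟩, h.2⟩

/-- The generating function of the parking functions on `S ∪ {r}` by their sum. -/
def parkingSum (ω : Sym2 V → ℕ) (t : R) (r : V) (S : Finset V) : R :=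
  ∑ α ∈ parkingMaps ω r S, ∏ i, t ^ α i

/-- Each function in the box is cut along its largest blocked set `U`: `β` is its restriction to
`U`, and `α` its restriction to `W \ U`. The cutoff `N` keeps the sums finite and exceeds every
parking value. -/
theorem sum_box_eq_sum_parkingSum (ω : Sym2 V → ℕ) (t : R) (r : V) (W : Finset V) {N : ℕ}
    (hN : degreeBound ω ≤ N) :
    ∑ α ∈ boxMaps W 0 N, ∏ i, t ^ α i = ∑ U ∈ W.powerset, parkingSum ω t r (W \ U) *
      ∑ β ∈ boxMaps U (fun i => ∑ j ∈ insert r (W \ U), ω s(i, j)) N, ∏ i, t ^ β i := by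
  simp only [parkingSum, Finset.sum_mul, Finset.mul_sum]
  rw [Finset.sum_sigma', Finset.sum_sigma']
  symm
  have hsum : ∀ {U : Finset V} {α β : V → ℕ}, U ⊆ W → α ∈ parkingMaps ω r (W \ U) →
      β ∈ boxMaps U (fun i => ∑ j ∈ insert r (W \ U), ω s(i, j)) N →
      (∀ i ∈ U, (α + β) i = β i) ∧ (∀ i ∉ U, (α + β) i = α i) ∧
      IsParkingOn ω r (W \ U) (α + β) ∧ IsBlocked ω r W U (α + β) := by
    intro U α β hU hα hβ
    rw [mem_parkingMaps] at hα
    rw [mem_boxMaps] at hβ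
    have h1 : ∀ i ∈ U, (α + β) i = β i := fun i hi => by
      simp [hα.1 i fun h => (Finset.mem_sdiff.1 h).2 hi]
    have h2 : ∀ i ∉ U, (α + β) i = α i := fun i hi => by simp [hβ.2 i hi]
    refine ⟨h1, h2, hα.2.congr fun i hi => (h2 i (Finset.mem_sdiff.1 hi).2).symm, ?_⟩
    intro i hi
    rw [h1 i hi]
    exact (hβ.1 i hi).1
  refine Finset.sum_bij (fun x _ => x.2 + x.1.2) ?_ ?_ ?_ ?_
  · rintro ⟨⟨U, β⟩, α⟩ hx
    simp only [Finset.mem_sigma, Finset.mem_powerset] at hx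
    obtain ⟨⟨hU, hβ⟩, hα⟩ := hx
    obtain ⟨h1, h2, -, -⟩ := hsum hU hα hβ
    rw [mem_parkingMaps] at hα
    rw [mem_boxMaps] at hβ ⊢
    refine ⟨fun i hi => ⟨Nat.zero_le _, ?_⟩, fun i hi => ?_⟩
    · by_cases hiU : i ∈ U
      · rw [h1 i hiU]; exact (hβ.1 i hiU).2
      · rw [h2 i hiU]; exact (hα.2.lt (Finset.mem_sdiff.2 ⟨hi, hiU⟩)).trans_le hN
    · rw [h2 i fun h => hi (hU h)]
      exact hα.1 i fun h => hi (Finset.mem_sdiff.1 h).1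
  · rintro ⟨⟨U, β⟩, α⟩ hx ⟨⟨U', β'⟩, α'⟩ hx' heq
    simp only [Finset.mem_sigma, Finset.mem_powerset] at hx hx' heq
    obtain ⟨⟨hU, hβ⟩, hα⟩ := hx
    obtain ⟨⟨hU', hβ'⟩, hα'⟩ := hx'
    obtain ⟨h1, h2, hp, hb⟩ := hsum hU hα hβ
    obtain ⟨h1', h2', hp', hb'⟩ := hsum hU' hα' hβ'
    rw [← heq] at h1' h2' hp' hb'
    have hUU : U = U' :=
      (hb.subset_of_isParkingOn hp' hU).antisymm (hb'.subset_of_isParkingOn hp hU')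
    subst hUU
    rw [mem_parkingMaps] at hα hα'
    rw [mem_boxMaps] at hβ hβ'
    have hαα : α = α' := by
      funext i
      by_cases hi : i ∈ U
      · rw [hα.1 i (by simp [hi]), hα'.1 i (by simp [hi])]
      · rw [← h2 i hi, ← h2' i hi]
    have hββ : β = β' := by
      funext i
      by_cases hi : i ∈ U
      · rw [← h1 i hi, ← h1' i hi]
      · rw [hβ.2 i hi, hβ'.2 i hi]
    rw [hαα, hββ]
  · intro γ hγ
    rw [mem_boxMaps] at hγ
    obtain ⟨U, hU, hp, hb⟩ := exists_isBlocked_isParkingOn ω r W γ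
    refine ⟨⟨⟨U, fun i => if i ∈ U then γ i else 0⟩, fun i => if i ∈ U then 0 else γ i⟩, ?_, ?_⟩
    · simp only [Finset.mem_sigma, Finset.mem_powerset, mem_parkingMaps, mem_boxMaps]
      refine ⟨⟨hU, fun i hi => ?_, fun i hi => ?_⟩, fun i hi => ?_, hp.congr fun i hi => ?_⟩
      · rw [if_pos hi]
        exact ⟨hb i hi, (hγ.1 i (hU hi)).2⟩
      · rw [if_neg hi]
      · split_ifs with h
        · rfl
        · exact hγ.2 i fun h' => hi (Finset.mem_sdiff.2 ⟨h', h⟩)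
      · rw [if_neg (Finset.mem_sdiff.1 hi).2]
    · funext i
      by_cases hi : i ∈ U <;> simp [hi]
  · rintro ⟨⟨U, β⟩, α⟩ _
    simp only [Pi.add_apply, pow_add, Finset.prod_mul_distrib]

theorem truncated_parkingSum (ω : Sym2 V → ℕ) (t : R) (r : V) (W : Finset V) {N : ℕ}
    (hN : degreeBound ω ≤ N) :
    (t ^ N - 1) ^ W.card = ∑ U ∈ W.powerset, parkingSum ω t r (W \ U) * (t - 1) ^ (W \ U).card *
      ∏ i ∈ U, (t ^ N - t ^ ∑ j ∈ insert r (W \ U), ω s(i, j)) := by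
  have h := sum_box_eq_sum_parkingSum ω t r W hN
  have hgeom : ∀ (U : Finset V) (d : V → ℕ), (∀ i, d i ≤ N) →
      (∑ β ∈ boxMaps U d N, ∏ i, t ^ β i) * (t - 1) ^ U.card = ∏ i ∈ U, (t ^ N - t ^ d i) := by
    intro U d hd
    rw [sum_boxMaps, ← Finset.prod_const, ← Finset.prod_mul_distrib]
    exact Finset.prod_congr rfl fun i _ => geom_sum_Ico_mul t (hd i)
  have h' := congrArg (· * (t - 1) ^ W.card) h
  simp only [hgeom W 0 fun _ => Nat.zero_le _] at h'
  simp only [Pi.zero_apply, pow_zero, Finset.prod_const] at h'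
  rw [h', Finset.sum_mul]
  refine Finset.sum_congr rfl fun U hU => ?_
  rw [← hgeom U _ fun i => (sum_le_degreeBound i _).trans hN,
    ← Finset.card_sdiff_add_card_eq_card (Finset.mem_powerset.1 hU), pow_add]
  ring

-- This is the limit `t ^ N → 0` made algebraic: the truncated identity is polynomial in `t ^ N` and
-- holds at infinitely many values, so `t ^ N` may be replaced by `0`.
open Polynomial in
theorem neg_one_pow_card_eq [IsDomain R] (ω : Sym2 V → ℕ) {t : R}
    (ht : Function.Injective fun n : ℕ => t ^ n) (r : V) (W : Finset V) :
    (-1) ^ W.card = ∑ U ∈ W.powerset, parkingSum ω t r (W \ U) * (t - 1) ^ (W \ U).card *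
      ∏ i ∈ U, - t ^ ∑ j ∈ insert r (W \ U), ω s(i, j) := by
  have key : (X - 1 : R[X]) ^ W.card = ∑ U ∈ W.powerset,
      C (parkingSum ω t r (W \ U) * (t - 1) ^ (W \ U).card) *
        ∏ i ∈ U, (X - C (t ^ ∑ j ∈ insert r (W \ U), ω s(i, j))) := by
    refine Polynomial.eq_of_infinite_eval_eq _ _ (Set.Infinite.mono ?_
      ((Set.Ici_infinite (degreeBound ω)).image ht.injOn))
    rintro _ ⟨N, hN, rfl⟩
    simp only [Set.mem_ofPred_eq, eval_pow, eval_sub, eval_X, eval_one, eval_finsetSum, eval_mul,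
      eval_C, eval_prod]
    exact truncated_parkingSum ω t r W hN
  have h := congrArg (eval 0) key
  simpa only [eval_pow, eval_sub, eval_X, eval_one, eval_finsetSum, eval_mul, eval_C, eval_prod,
    zero_sub] using h

/-- Multiply by `(-1) ^ W.card * q ^ edgesIn ω (insert r W)`. Edges of `W ∪ {r}` lie inside `U`,
inside its complement, or between them, and the last kind cancels the power of `t`. -/
theorem pow_edgesIn_eq_sum_parkingSum [IsDomain R] (hω : ∀ v, ω s(v, v) = 0) {q t : R}
    (hqt : q * t = 1) (ht : Function.Injective fun n : ℕ => t ^ n) {r : V} {W : Finset V}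
    (hr : r ∉ W) :
    q ^ edgesIn ω (insert r W) = ∑ U ∈ W.powerset, (1 - t) ^ (W \ U).card *
      q ^ edgesIn ω (insert r (W \ U)) * parkingSum ω t r (W \ U) * q ^ edgesIn ω U := by
  have h := congrArg (fun y => (-1) ^ W.card * q ^ edgesIn ω (insert r W) * y)
    (neg_one_pow_card_eq ω ht r W)
  have hsq : ∀ n : ℕ, ((-1 : R) ^ n) * (-1) ^ n = 1 := fun n => by
    rw [← mul_pow]; simp
  simp only [Finset.mul_sum] at h
  rw [mul_right_comm, hsq, one_mul] at h
  rw [h]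
  refine Finset.sum_congr rfl fun U hU => ?_
  rw [Finset.mem_powerset] at hU
  have hd : Disjoint (insert r (W \ U)) U :=
    Finset.disjoint_insert_left.2 ⟨fun h => hr (hU h), Finset.sdiff_disjoint⟩
  have hE := edgesIn_union hω hd
  rw [Finset.insert_union, Finset.sdiff_union_of_subset hU] at hE
  have hprod : ∏ i ∈ U, - t ^ ∑ j ∈ insert r (W \ U), ω s(i, j) =
      (-1) ^ U.card * t ^ ∑ i ∈ U, ∑ j ∈ insert r (W \ U), ω s(i, j) := by
    rw [Finset.prod_neg, Finset.prod_pow_eq_pow_sum]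
  have hone : (1 - t) ^ (W \ U).card = (-1) ^ (W \ U).card * (t - 1) ^ (W \ U).card := by
    rw [← mul_pow]; ring
  have hqt' : ∀ n : ℕ, q ^ n * t ^ n = 1 := fun n => by rw [← mul_pow, hqt, one_pow]
  rw [hprod, hone, hE, pow_add, pow_add, ← Finset.card_sdiff_add_card_eq_card hU, pow_add]
  linear_combination ((-1) ^ (W \ U).card * (t - 1) ^ (W \ U).card *
    q ^ edgesIn ω (insert r (W \ U)) * parkingSum ω t r (W \ U) * q ^ edgesIn ω U) *
    ((-1) ^ U.card * (-1) ^ U.card * hqt' (∑ i ∈ U, ∑ j ∈ insert r (W \ U), ω s(i, j))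
      + hsq U.card)

theorem parkingSum_eq_treeSum [IsDomain R] {α : Type*} [LinearOrder α] {f : V → α}
    (hf : Function.Injective f) (hω : ∀ v, ω s(v, v) = 0) {q t : R}
    (hqt : q * t = 1) (ht : Function.Injective fun n : ℕ => t ^ n) {r : V} {W : Finset V}
    (hr : r ∉ W) :
    (1 - t) ^ W.card * q ^ edgesIn ω (insert r W) * parkingSum ω t r W =
      treeSum ω f q r W := by
  obtain ⟨C, hC, h1, hrec⟩ := SetFunction.exists_connected_part
    (A := ⟨fun X : Finset V => q ^ edgesIn ω X⟩) (fun r j => q ^ ω s(r, j))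
    (by simp [edgesIn_empty]) (mark_pow_edgesIn hω q)
  rw [treeSum_eq_of_recursion ω hf q h1 hrec r W hr]
  -- The normalized parking sum, supported on sets containing `r`, is the candidate for the
  -- logarithmic derivative of `A`.
  have h := hC ⟨fun X => if r ∈ X then (1 - t) ^ (X.erase r).card *
    q ^ edgesIn ω X * parkingSum ω t r (X.erase r) else 0⟩ r ?_ _ (Finset.mem_insert_self r W)
  · simpa [Finset.erase_insert hr] using h
  refine SetFunction.ext_apply fun X => ?_
  rw [SetFunction.mark_apply, SetFunction.mul_apply]
  split_ifs with hrX
  · obtain ⟨Y, hrY, rfl⟩ : ∃ Y, r ∉ Y ∧ insert r Y = X :=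
      ⟨X.erase r, Finset.notMem_erase r X, Finset.insert_erase hrX⟩
    rw [Finset.sum_powerset_insert hrY, Finset.sum_eq_zero, zero_add]
    · simp only
      rw [pow_edgesIn_eq_sum_parkingSum hω hqt ht hrY]
      -- The convolution block containing `r` is `insert r (Y \ U)`; its complement is the blocked
      -- set `U`.
      refine Finset.sum_nbij' (fun U => Y \ U) (fun U => Y \ U) (by simp) (by simp) ?_ ?_ ?_
      · intro U hU; simpa using hU
      · intro U hU; simpa using hU
      · intro U hU
        have hr' : r ∉ Y \ U := fun h => hrY (Finset.mem_sdiff.1 h).1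
        have hrU : r ∉ U := fun h => hrY (Finset.mem_powerset.1 hU h)
        have : insert r Y \ insert r (Y \ U) = U := by
          have hUY := Finset.mem_powerset.1 hU
          rw [Finset.insert_sdiff_insert, Finset.sdiff_insert_of_notMem hrY,
            Finset.sdiff_sdiff_eq_self hUY]
        rw [this, if_pos (Finset.mem_insert_self _ _), Finset.erase_insert hr']
    · intro B hB
      simp only
      rw [if_neg fun h => hrY (Finset.mem_powerset.1 hB h), zero_mul]
  · refine (Finset.sum_eq_zero fun B hB => ?_).symm
    simp only
    rw [if_neg fun h => hrX (Finset.mem_powerset.1 hB h), zero_mul]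

end ParkingSum

/-! ### Spanning trees correspond to parent maps. -/

section ParentGraph

variable {V : Type*}

/-- The graph whose edges join each vertex to its image under `p`. -/
def parentGraph (p : V → V) : SimpleGraph V := SimpleGraph.fromRel fun a b => p a = b

theorem parentGraph_adj {p : V → V} {a b : V} :
    (parentGraph p).Adj a b ↔ a ≠ b ∧ (p a = b ∨ p b = a) := SimpleGraph.fromRel_adj _ _ _

variable [Fintype V] [DecidableEq V] {r : V} {p : V → V}

namespace IsTreeMap

variable (hp : IsTreeMap r (Finset.univ.erase r) p)

include hp in
theorem reaches_root (i : V) : Reaches p i r := by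
  by_cases h : i = r
  · rw [h]
  · exact hp.reaches i (by simp [h])

include hp in
theorem root_fixed : p r = r := hp.fixed r (by simp)

include hp in
theorem map_ne {i : V} (hi : i ≠ r) : p i ≠ i := fun h =>
  hi (Reaches.eq_of_fixed h (hp.reaches_root i)).symm

include hp in
theorem parentGraph_adj_map {i : V} (hi : i ≠ r) : (parentGraph p).Adj i (p i) :=
  parentGraph_adj.2 ⟨(hp.map_ne hi).symm, .inl rfl⟩

include hp in
theorem connected_parentGraph : (parentGraph p).Connected := by
  have key : ∀ i, (parentGraph p).Reachable i r := by
    intro i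
    have h := hp.reaches_root i
    induction h using Relation.ReflTransGen.head_induction_on with
    | refl => exact .refl _
    | @head a c hac _ ih =>
      subst hac
      by_cases ha : a = r
      · rw [ha]
      · exact (hp.parentGraph_adj_map ha).reachable.trans ih
  have : Nonempty V := ⟨r⟩
  exact ⟨fun i j => (key i).trans (key j).symm⟩

include hp in
-- Two vertices with the same parent edge would be each other's parents, a cycle that never reaches
-- the root.
theorem injOn_edge : Set.InjOn (fun i => s(p i, i)) (Finset.univ.erase r : Finset V) := by
  intro i hi j hj h
  have hi : i ≠ r := by simpa using hi
  simp only [Sym2.eq_iff] at h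
  rcases h with ⟨_, h⟩ | ⟨h1, h2⟩
  · exact h
  · exfalso
    refine hi (Reaches.antisymm_of_fixed hp.root_fixed (hp.reaches_root i) ?_)
    rw [h1, h2]
    exact .step p j

include hp in
theorem mem_edgeSet_parentGraph {e : Sym2 V} :
    e ∈ (parentGraph p).edgeSet ↔ e ∈ (Finset.univ.erase r).image fun i => s(p i, i) := by
  induction e using Sym2.ind with
  | _ a b =>
    simp only [SimpleGraph.mem_edgeSet, parentGraph_adj, Finset.mem_image, Finset.mem_erase,
      Finset.mem_univ, and_true, Sym2.eq_iff]
    constructor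
    · rintro ⟨hne, rfl | rfl⟩
      · refine ⟨a, fun h => hne ?_, .inr ⟨rfl, rfl⟩⟩
        rw [h, hp.root_fixed]
      · refine ⟨b, fun h => hne ?_, .inl ⟨rfl, rfl⟩⟩
        rw [h, hp.root_fixed]
    · rintro ⟨i, hi, ⟨rfl, rfl⟩ | ⟨rfl, rfl⟩⟩
      · exact ⟨hp.map_ne hi, .inr rfl⟩
      · exact ⟨(hp.map_ne hi).symm, .inl rfl⟩

include hp in
theorem isTree_parentGraph : (parentGraph p).IsTree := by
  rw [SimpleGraph.isTree_iff_connected_and_card]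
  refine ⟨hp.connected_parentGraph, ?_⟩
  have : (parentGraph p).edgeSet = ((Finset.univ.erase r).image fun i => s(p i, i) : Finset _) :=
    Set.ext fun e => hp.mem_edgeSet_parentGraph
  rw [this, Nat.card_coe_set_eq, Set.ncard_coe_finset, Finset.card_image_of_injOn hp.injOn_edge,
    Nat.card_eq_fintype_card, Finset.card_erase_add_one (Finset.mem_univ r), Finset.card_univ]

-- `H` is arbitrary so that this serves both for `parentGraph p` and for a given spanning tree;
-- uniqueness of paths then identifies the tree order and the parents.
include hp in
theorem exists_path {H : SimpleGraph V} (hH : ∀ i, i ≠ r → H.Adj i (p i)) (i : V) :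
    ∃ w : H.Walk i r, w.IsPath ∧ (∀ x, x ∈ w.support ↔ Reaches p i x) ∧ (i ≠ r → w.snd = p i) := by
  have h := hp.reaches_root i
  induction h using Relation.ReflTransGen.head_induction_on with
  | refl =>
    refine ⟨.nil, .nil, fun x => ?_, fun h => absurd rfl h⟩
    rw [SimpleGraph.Walk.support_nil, List.mem_singleton]
    constructor
    · rintro rfl; exact .refl
    · exact Reaches.eq_of_fixed hp.root_fixed
  | @head a c hac h ih =>
    by_cases ha : a = r
    · subst hac
      have : p a = a := by rw [ha, hp.root_fixed]
      rwa [this] at ih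
    · subst hac
      obtain ⟨w, hw, hs, -⟩ := ih
      refine ⟨.cons (hH a ha) w, ?_, fun x => ?_, fun _ => ?_⟩
      · rw [SimpleGraph.Walk.cons_isPath_iff]
        refine ⟨hw, fun h => ha ?_⟩
        exact Reaches.antisymm_of_fixed hp.root_fixed (hp.reaches_root a) ((hs a).1 h)
      · rw [SimpleGraph.Walk.support_cons, List.mem_cons, hs]
        constructor
        · rintro (rfl | h)
          · exact .refl
          · exact .head rfl h
        · intro h
          rcases h.cases_head with h | ⟨c, rfl, h⟩
          · exact .inl h.symm
          · exact .inr h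
      · simp

end IsTreeMap

end ParentGraph

namespace RootedMultigraph.SpanningTree

variable {V : Type*} [Fintype V] [DecidableEq V] {G : RootedMultigraph V} (T : G.SpanningTree)

theorem isPath_pathToRoot (i : V) : (T.pathToRoot i).IsPath :=
  (T.isTree.existsUnique_path i G.root).choose_spec.1

theorem eq_pathToRoot {i : V} {w : T.graph.Walk i G.root} (hw : w.IsPath) : w = T.pathToRoot i :=
  (T.isTree.existsUnique_path i G.root).choose_spec.2 w hw

/-- The parent function, extended by fixing the root. -/
def parentMap (i : V) : V := if h : i = G.root then i else T.parent ⟨i, h⟩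

theorem parentMap_of_ne {i : V} (h : i ≠ G.root) : T.parentMap i = T.parent ⟨i, h⟩ := dif_neg h

theorem not_nil_pathToRoot {i : V} (h : i ≠ G.root) : ¬ (T.pathToRoot i).Nil :=
  SimpleGraph.Walk.not_nil_of_ne h

theorem adj_parentMap {i : V} (h : i ≠ G.root) : T.graph.Adj i (T.parentMap i) := by
  rw [parentMap_of_ne T h]
  exact SimpleGraph.Walk.adj_snd (T.not_nil_pathToRoot h)

theorem isTreeMap_parentMap : IsTreeMap G.root (Finset.univ.erase G.root) T.parentMap where
  fixed i hi := dif_pos (by simpa using hi)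
  reaches i hi := by
    clear hi
    induction hn : (T.pathToRoot i).length using Nat.strong_induction_on generalizing i with
    | _ n ih =>
      by_cases h : i = G.root
      · rw [h]
      · have hnil := T.not_nil_pathToRoot h
        have htail : (T.pathToRoot i).tail = T.pathToRoot (T.pathToRoot i).snd :=
          T.eq_pathToRoot (T.isPath_pathToRoot i).tail
        have hlen := SimpleGraph.Walk.length_tail_add_one hnil
        refine .head (T.parentMap_of_ne h) ?_
        exact ih _ (by rw [← hn, ← hlen, htail]; exact Nat.lt_succ_self _) _ rfl

theorem le_iff_reaches {p : V → V} (hp : IsTreeMap G.root (Finset.univ.erase G.root) p)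
    (hT : ∀ i, i ≠ G.root → T.graph.Adj i (p i)) (i j : V) : T.Le i j ↔ Reaches p j i := by
  obtain ⟨w, hw, hs, -⟩ := hp.exists_path hT j
  rw [Le, ← T.eq_pathToRoot hw, hs]

theorem parentMap_eq {p : V → V} (hp : IsTreeMap G.root (Finset.univ.erase G.root) p)
    (hT : ∀ i, i ≠ G.root → T.graph.Adj i (p i)) : T.parentMap = p := by
  funext i
  by_cases h : i = G.root
  · rw [h, hp.root_fixed, T.isTreeMap_parentMap.root_fixed]
  · obtain ⟨w, hw, -, hs⟩ := hp.exists_path hT i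
    rw [parentMap_of_ne T h, parent, ← hs h, ← T.eq_pathToRoot hw]

/-- The parent graph is a connected subgraph of the tree, and a tree is minimal among connected
graphs. -/
theorem parentGraph_parentMap : parentGraph T.parentMap = T.graph := by
  have hle : parentGraph T.parentMap ≤ T.graph := by
    intro a b hab
    obtain ⟨hne, rfl | rfl⟩ := parentGraph_adj.1 hab
    · refine T.adj_parentMap fun h => hne ?_
      rw [h, T.isTreeMap_parentMap.root_fixed]
    · refine (T.adj_parentMap fun h => hne ?_).symm
      rw [h, T.isTreeMap_parentMap.root_fixed]
  exact le_antisymm hle ((SimpleGraph.isTree_iff_minimal_connected.1 T.isTree).2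
    T.isTreeMap_parentMap.connected_parentGraph hle)

theorem parentMap_injective : Function.Injective (parentMap : G.SpanningTree → V → V) := by
  intro S T h
  apply graph_injective
  rw [← parentGraph_parentMap, ← parentGraph_parentMap, h]

theorem exists_parentMap_eq {p : V → V} (hp : IsTreeMap G.root (Finset.univ.erase G.root) p)
    (hpos : ∀ i, i ≠ G.root → 1 ≤ G.weight s(p i, i)) : ∃ T : G.SpanningTree, T.parentMap = p := by
  refine ⟨⟨parentGraph p, hp.isTree_parentGraph, fun e he => ?_⟩, ?_⟩
  · obtain ⟨i, hi, rfl⟩ := Finset.mem_image.1 (hp.mem_edgeSet_parentGraph.1 he)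
    exact hpos i (Finset.ne_of_mem_erase hi)
  · exact parentMap_eq _ hp fun i hi => hp.parentGraph_adj_map hi

theorem prod_edges {M : Type*} [CommMonoid M] (g : Sym2 V → M) :
    ∏ e ∈ T.edges, g e = ∏ i ∈ Finset.univ.erase G.root, g s(T.parentMap i, i) := by
  rw [← Finset.prod_image (f := g) T.isTreeMap_parentMap.injOn_edge]
  congr 1
  ext e
  rw [← T.isTreeMap_parentMap.mem_edgeSet_parentGraph, parentGraph_parentMap]
  simp [edges]

open Classical in
theorem kappa_eq {α : Type*} [LinearOrder α] (prec : G.NonRoot → G.NonRoot → Prop) {f : V → α}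
    (hf : ∀ i j : G.NonRoot, prec i j ↔ f i < f j) :
    T.kappa prec = ∑ i ∈ Finset.univ.erase G.root, ∑ j ∈ Finset.univ.erase G.root with
      f j < f i ∧ Reaches T.parentMap j i, G.weight s(T.parentMap i, j) := by
  have hmem : ∀ x, x ∈ Finset.univ.erase G.root ↔ x ≠ G.root := by simp
  rw [Finset.sum_subtype _ hmem, kappa]
  refine Finset.sum_congr rfl fun i _ => ?_
  rw [Finset.sum_filter, Finset.sum_subtype _ hmem]
  refine Finset.sum_congr rfl fun j _ => ?_
  rw [T.parentMap_of_ne i.2, hf,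
    T.le_iff_reaches T.isTreeMap_parentMap fun i hi => T.adj_parentMap hi]
  simp only [and_comm]

end RootedMultigraph.SpanningTree

/-! ### Laurent polynomial normalization and the identity for multigraphs. -/

open LaurentPolynomial in
theorem T_one_pow (k : ℕ) : (T 1 : LaurentPolynomial ℤ) ^ k = T (k : ℤ) := by
  rw [T_pow, mul_one]

open LaurentPolynomial in
theorem T_neg_one_pow (k : ℕ) : (T (-1) : LaurentPolynomial ℤ) ^ k = T (-(k : ℤ)) := by
  rw [T_pow, mul_neg_one]

theorem laurentPolynomial_T_injective :
    Function.Injective (LaurentPolynomial.T : ℤ → LaurentPolynomial ℤ) := fun m n h => by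
  have h' := congrArg LaurentPolynomial.degree h
  rw [LaurentPolynomial.degree_T, LaurentPolynomial.degree_T] at h'
  exact WithBot.coe_injective h'

theorem pow_sub_one_eq_qNumber (k : ℕ) :
    (LaurentPolynomial.T 1 : LaurentPolynomial ℤ) ^ k - 1 =
      (LaurentPolynomial.T 1 - 1) * qNumber k := by
  rw [qNumber, ← mul_geom_sum]
  simp only [T_one_pow]

theorem qNumber_one : qNumber 1 = 1 := by simp [qNumber]

theorem qNumber_zero : qNumber 0 = 0 := by simp [qNumber]

namespace RootedMultigraph

section Main

variable {V : Type*} [Fintype V] [DecidableEq V] (G : RootedMultigraph V)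

theorem mem_erase_root {x : V} : x ∈ Finset.univ.erase G.root ↔ x ≠ G.root := by simp

theorem edgeCount_eq_edgesIn : G.edgeCount = edgesIn G.weight Finset.univ := by
  simp [edgeCount, edgesIn]

theorem isParkingOn_iff (β : V → ℕ) :
    IsParkingOn G.weight G.root (Finset.univ.erase G.root) β ↔ G.IsParking fun i => β i := by
  have hset : ∀ U : Finset V, U ⊆ Finset.univ.erase G.root →
      insert G.root (Finset.univ.erase G.root \ U) = Finset.univ \ U := by
    intro U hU
    have hr : G.root ∉ U := fun h => Finset.notMem_erase _ _ (hU h)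
    rw [← Finset.insert_sdiff_of_notMem _ hr, Finset.insert_erase (Finset.mem_univ _)]
  constructor
  · intro h U hU
    have hsub : U.map (Function.Embedding.subtype _) ⊆ Finset.univ.erase G.root := by
      intro x hx
      obtain ⟨i, -, rfl⟩ := Finset.mem_map.1 hx
      exact G.mem_erase_root.2 i.2
    obtain ⟨x, hx, hlt⟩ := h _ hsub (hU.map)
    obtain ⟨i, hi, rfl⟩ := Finset.mem_map.1 hx
    rw [hset _ hsub] at hlt
    exact ⟨i, hi, hlt⟩
  · intro h U hU hne
    have hmap : (U.subtype (· ≠ G.root)).map (Function.Embedding.subtype _) = U := by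
      rw [Finset.subtype_map, Finset.filter_true_of_mem]
      exact fun x hx => G.mem_erase_root.1 (hU hx)
    obtain ⟨x, hx⟩ := hne
    obtain ⟨i, hi, hlt⟩ := h (U.subtype (· ≠ G.root))
      ⟨⟨x, G.mem_erase_root.1 (hU hx)⟩, Finset.mem_subtype.2 hx⟩
    refine ⟨i, Finset.mem_subtype.1 hi, ?_⟩
    rw [hset U hU]
    unfold degOut at hlt
    rwa [hmap] at hlt

theorem mem_parkingFunctions {α : G.NonRoot → ℕ} : α ∈ G.parkingFunctions ↔ G.IsParking α := by
  simp [parkingFunctions]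

theorem card_nonRoot : Fintype.card G.NonRoot = (Finset.univ.erase G.root).card :=
  Fintype.card_of_subtype _ fun _ => G.mem_erase_root

/-- Since `1 - q⁻¹ = (q - 1) * q⁻¹`, the prefactor leaves `q` to the power `#E - n - ∑ α`, which is
`rsum`. -/
theorem parkingSum_eq :
    (1 - LaurentPolynomial.T (-1)) ^ (Finset.univ.erase G.root).card *
        LaurentPolynomial.T 1 ^ edgesIn G.weight Finset.univ *
        parkingSum G.weight (LaurentPolynomial.T (-1)) G.root (Finset.univ.erase G.root) =
      (LaurentPolynomial.T 1 - 1 : LaurentPolynomial ℤ) ^ (Finset.univ.erase G.root).card *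
        ∑ α ∈ G.parkingFunctions, LaurentPolynomial.T (G.rsum α) := by
  have hone : (1 - LaurentPolynomial.T (-1) : LaurentPolynomial ℤ) =
      (LaurentPolynomial.T 1 - 1) * LaurentPolynomial.T (-1) := by
    rw [sub_mul, ← LaurentPolynomial.T_add, one_mul]
    simp
  rw [hone, mul_pow, mul_assoc, mul_assoc]
  congr 1
  rw [parkingSum, Finset.mul_sum, Finset.mul_sum]
  refine Finset.sum_bij' (fun β _ i => β i)
    (fun α _ x => if h : x ≠ G.root then α ⟨x, h⟩ else 0) ?_ ?_ ?_ ?_ ?_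
  · intro β hβ
    exact G.mem_parkingFunctions.2 ((G.isParkingOn_iff β).1 (mem_parkingMaps.1 hβ).2)
  · intro α hα
    rw [mem_parkingMaps, isParkingOn_iff]
    refine ⟨fun i hi => dif_neg fun h => hi (G.mem_erase_root.2 h), ?_⟩
    convert G.mem_parkingFunctions.1 hα using 2 with i
    simp [i.2]
  · intro β hβ
    funext x
    by_cases h : x = G.root
    · simp [h, (mem_parkingMaps.1 hβ).1 G.root (Finset.notMem_erase _ _)]
    · simp [h]
  · intro α _
    funext i
    simp [i.2]
  · intro β hβ
    have hsum : ∑ i : G.NonRoot, (β i : ℤ) = ∑ i, (β i : ℤ) := by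
      rw [← Finset.sum_subtype (Finset.univ.erase G.root) (fun _ => G.mem_erase_root)
        (fun i => (β i : ℤ))]
      refine Finset.sum_subset (Finset.subset_univ _) fun i _ hi => ?_
      rw [(mem_parkingMaps.1 hβ).1 i hi, Nat.cast_zero]
    rw [Finset.prod_pow_eq_pow_sum, T_neg_one_pow, T_one_pow, T_neg_one_pow,
      ← LaurentPolynomial.T_add, ← LaurentPolynomial.T_add, rsum, hsum, card_nonRoot,
      edgeCount_eq_edgesIn]
    congr 1
    push_cast
    ring

theorem treeSum_eq {α : Type*} [LinearOrder α] (prec : G.NonRoot → G.NonRoot → Prop) {f : V → α}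
    (hf : ∀ i j : G.NonRoot, prec i j ↔ f i < f j) :
    treeSum G.weight f (LaurentPolynomial.T 1) G.root (Finset.univ.erase G.root) =
      (LaurentPolynomial.T 1 - 1 : LaurentPolynomial ℤ) ^ (Finset.univ.erase G.root).card *
        ∑ T : G.SpanningTree, LaurentPolynomial.T (T.kappa prec : ℤ) *
          ∏ e ∈ T.edges, qNumber (G.weight e) := by
  classical
  have hprod : ∀ p : V → V,
      ∏ i ∈ Finset.univ.erase G.root,
        edgeFactor G.weight f (LaurentPolynomial.T 1 : LaurentPolynomial ℤ)
          (Finset.univ.erase G.root) p i =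
      (LaurentPolynomial.T 1 - 1) ^ (Finset.univ.erase G.root).card *
        (LaurentPolynomial.T ((∑ i ∈ Finset.univ.erase G.root,
          ∑ j ∈ Finset.univ.erase G.root with f j < f i ∧ Reaches p j i,
            G.weight s(p i, j) : ℕ) : ℤ) *
        ∏ i ∈ Finset.univ.erase G.root, qNumber (G.weight s(p i, i))) := by
    intro p
    simp only [edgeFactor, Finset.prod_mul_distrib, Finset.prod_pow_eq_pow_sum,
      pow_sub_one_eq_qNumber, Finset.prod_const]
    rw [T_one_pow]
    ring
  rw [treeSum, Finset.sum_congr rfl fun p _ => hprod p, ← Finset.mul_sum]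
  congr 1
  symm
  refine Finset.sum_of_injOn SpanningTree.parentMap SpanningTree.parentMap_injective.injOn
    (fun T _ => mem_treeMaps.2 T.isTreeMap_parentMap) ?_ ?_
  -- A tree map not coming from a spanning tree uses a pair of weight `0`, and `[0]_q = 0` removes
  -- it.
  · intro p hp hnot
    rw [mem_treeMaps] at hp
    obtain ⟨i, hi, h0⟩ : ∃ i, i ≠ G.root ∧ G.weight s(p i, i) = 0 := by
      by_contra! hcon
      obtain ⟨T, rfl⟩ := SpanningTree.exists_parentMap_eq hp
        fun i hi => Nat.one_le_iff_ne_zero.2 (hcon i hi)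
      exact hnot ⟨T, by simp, rfl⟩
    rw [Finset.prod_eq_zero (G.mem_erase_root.2 hi) (by rw [h0, qNumber_zero]), mul_zero]
  · intro T _
    rw [T.kappa_eq prec hf, T.prod_edges fun e => qNumber (G.weight e)]

theorem sum_parkingFunctions_eq (prec : G.NonRoot → G.NonRoot → Prop)
    [IsStrictTotalOrder G.NonRoot prec] :
    ∑ α ∈ G.parkingFunctions, (LaurentPolynomial.T (G.rsum α) : LaurentPolynomial ℤ) =
      ∑ T : G.SpanningTree,
        LaurentPolynomial.T (T.kappa prec : ℤ) * ∏ e ∈ T.edges, qNumber (G.weight e) := by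
  classical
  let _ : LinearOrder G.NonRoot := linearOrderOfSTO prec
  -- The tree sum needs an injective key on all of `V`. Placing the root at the bottom is harmless,
  -- as `κ` compares only non-root vertices.
  let f : V → WithBot G.NonRoot := fun v => if h : v ≠ G.root then ((⟨v, h⟩ : G.NonRoot) : WithBot _)
    else ⊥
  have hfi : ∀ i : G.NonRoot, f i = (i : WithBot _) := fun i => dif_pos i.2
  have hfr : f G.root = ⊥ := dif_neg (by simp)
  have hinj : Function.Injective f := by
    intro u v h
    by_cases hu : u = G.root <;> by_cases hv : v = G.root
    · rw [hu, hv]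
    · rw [hu, hfr, hfi ⟨v, hv⟩] at h
      exact absurd h.symm (WithBot.coe_ne_bot)
    · rw [hv, hfr, hfi ⟨u, hu⟩] at h
      exact absurd h (WithBot.coe_ne_bot)
    · rw [hfi ⟨u, hu⟩, hfi ⟨v, hv⟩] at h
      exact congrArg Subtype.val (WithBot.coe_injective h)
  have hf : ∀ i j : G.NonRoot, prec i j ↔ f i < f j := fun i j => by
    rw [hfi, hfi, WithBot.coe_lt_coe]
    rfl
  have hqt : (LaurentPolynomial.T 1 * LaurentPolynomial.T (-1) : LaurentPolynomial ℤ) = 1 := by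
    rw [← LaurentPolynomial.T_add]; simp
  have ht : Function.Injective fun n : ℕ => (LaurentPolynomial.T (-1) : LaurentPolynomial ℤ) ^ n := by
    intro m n h
    simp only [T_neg_one_pow] at h
    have := laurentPolynomial_T_injective h
    omega
  have h := parkingSum_eq_treeSum hinj G.weight_diag hqt ht (Finset.notMem_erase G.root Finset.univ)
  rw [Finset.insert_erase (Finset.mem_univ _), G.parkingSum_eq, G.treeSum_eq prec hf] at h
  -- Both sides carry the factor `(q - 1) ^ n`, which is nonzero in a domain.
  refine mul_left_cancel₀ (pow_ne_zero _ (sub_ne_zero.2 ?_)) h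
  intro h1
  rw [← LaurentPolynomial.T_zero] at h1
  exact absurd (laurentPolynomial_T_injective h1) one_ne_zero

theorem prod_qNumber_edges_eq_one {G : RootedMultigraph V} (hG : ∀ e, G.weight e ≤ 1)
    (T : G.SpanningTree) : ∏ e ∈ T.edges, qNumber (G.weight e) = 1 := by
  refine Finset.prod_eq_one fun e he => ?_
  have h1 := T.weight_pos e (by simpa [SpanningTree.edges] using he)
  rw [le_antisymm (hG e) h1, qNumber_one]

end Main

/-! ### The complete multigraph and vector parking functions. -/

section CompleteAB

variable (n a b : ℕ)

theorem completeAB_weight_zero {j : Fin (n + 1)} (hj : j ≠ 0) :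
    (completeAB n a b).weight s(0, j) = a := by
  simp [completeAB, hj.symm]

theorem completeAB_weight {i j : Fin (n + 1)} (hi : i ≠ 0) (hj : j ≠ 0) (hij : i ≠ j) :
    (completeAB n a b).weight s(i, j) = b := by
  simp [completeAB, hij, hi.symm, hj.symm]

theorem two_mul_edgesIn_completeAB {X : Finset (Fin (n + 1))} (h0 : 0 ∉ X) :
    2 * (edgesIn (completeAB n a b).weight X : ℤ) = b * (X.card * (X.card - 1)) := by
  induction X using Finset.induction_on with
  | empty => simp [edgesIn_empty]
  | insert r X hr ih =>
    rw [Finset.mem_insert, not_or] at h0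
    have hsum : ∑ j ∈ X, (completeAB n a b).weight s(r, j) = X.card * b := by
      rw [Finset.sum_congr rfl fun j hj => completeAB_weight n a b (Ne.symm h0.1)
        (fun h => h0.2 (h ▸ hj)) (fun h => hr (h ▸ hj))]
      simp
    rw [edgesIn_insert (completeAB n a b).weight_diag hr, hsum, Finset.card_insert_of_notMem hr]
    push_cast
    rw [mul_add, ih h0.2]
    ring

theorem two_mul_edgeCount_completeAB :
    2 * ((completeAB n a b).edgeCount : ℤ) = 2 * n * a + b * (n * (n - 1)) := by
  have h0 : (0 : Fin (n + 1)) ∉ Finset.univ.erase 0 := Finset.notMem_erase _ _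
  have hcard : (Finset.univ.erase (0 : Fin (n + 1))).card = n := by simp
  have hsum : ∑ j ∈ Finset.univ.erase 0, (completeAB n a b).weight s(0, j) = n * a := by
    rw [Finset.sum_congr rfl fun j hj => completeAB_weight_zero n a b (Finset.ne_of_mem_erase hj)]
    simp
  rw [edgeCount_eq_edgesIn, ← Finset.insert_erase (Finset.mem_univ (0 : Fin (n + 1))),
    edgesIn_insert (completeAB n a b).weight_diag h0, hsum]
  push_cast
  rw [mul_add, two_mul_edgesIn_completeAB n a b h0, hcard]
  ring

theorem two_mul_sum_vecAB (hn : 1 ≤ n) :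
    2 * ∑ i : Fin n, ((n : ℤ) - (i : ℤ)) * (VectorParking.vecAB n a b i : ℤ) =
      2 * n * a + b * (n * (n - 1)) := by
  obtain ⟨m, rfl⟩ : ∃ m, n = m + 1 := ⟨n - 1, by omega⟩
  rw [Fin.sum_univ_succ]
  have hg : ∀ m : ℕ, 2 * ∑ i ∈ Finset.range m, ((m : ℤ) - i) * b = b * ((m + 1) * m) := by
    intro m
    induction m with
    | zero => simp
    | succ m ih =>
      have h : ∑ i ∈ Finset.range m, (((m + 1 : ℕ) : ℤ) - (i + 1 : ℕ)) * b =
          ∑ i ∈ Finset.range m, ((m : ℤ) - i) * b :=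
        Finset.sum_congr rfl fun i _ => by push_cast; ring
      rw [Finset.sum_range_succ', h, mul_add, ih]
      push_cast
      ring
  have : ∑ i : Fin m, (((m + 1 : ℕ) : ℤ) - (i.succ : Fin (m + 1))) *
      (VectorParking.vecAB (m + 1) a b i.succ : ℤ) = ∑ i ∈ Finset.range m, ((m : ℤ) - i) * b := by
    rw [← Fin.sum_univ_eq_sum_range fun i => ((m : ℤ) - i) * b]
    refine Finset.sum_congr rfl fun i _ => ?_
    simp [VectorParking.vecAB]
  rw [this, mul_add, hg]
  simp [VectorParking.vecAB]
  ring

/-- The non-root vertices of `completeAB n a b`, indexed by `Fin n`. -/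
def nonRootEquiv : (completeAB n a b).NonRoot ≃ Fin n where
  toFun i := Fin.pred i.1 i.2
  invFun j := ⟨j.succ, Fin.succ_ne_zero j⟩
  left_inv i := Subtype.ext (Fin.succ_pred i.1 i.2)
  right_inv j := Fin.pred_succ j

theorem degOut_completeAB (U : Finset (completeAB n a b).NonRoot) {i : (completeAB n a b).NonRoot}
    (hi : i ∈ U) : (completeAB n a b).degOut U i = a + b * (n - U.card) := by
  have h0 : (0 : Fin (n + 1)) ∉ U.map (Function.Embedding.subtype _) := by
    intro h
    obtain ⟨j, -, hj⟩ := Finset.mem_map.1 h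
    exact j.2 hj
  have hi0 : (i : Fin (n + 1)) ≠ 0 := i.2
  have him : (i : Fin (n + 1)) ∈ U.map (Function.Embedding.subtype _) :=
    Finset.mem_map_of_mem _ hi
  unfold degOut
  rw [← Finset.insert_erase (Finset.mem_sdiff.2 ⟨Finset.mem_univ _, h0⟩),
    Finset.sum_insert (Finset.notMem_erase _ _), Sym2.eq_swap, completeAB_weight_zero n a b hi0]
  congr 1
  have hw : ∀ j ∈ (Finset.univ \ U.map (Function.Embedding.subtype _)).erase (0 : Fin (n + 1)),
      (completeAB n a b).weight s((i : Fin (n + 1)), j) = b := by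
    intro j hj
    obtain ⟨hj0, hj⟩ := Finset.mem_erase.1 hj
    exact completeAB_weight n a b hi0 hj0 fun h => (Finset.mem_sdiff.1 hj).2 (h ▸ him)
  rw [Finset.sum_congr rfl hw, Finset.sum_const, smul_eq_mul, mul_comm,
    Finset.card_erase_of_mem (Finset.mem_sdiff.2 ⟨Finset.mem_univ _, h0⟩),
    Finset.card_sdiff_of_subset (Finset.subset_univ _), Finset.card_map, Finset.card_univ,
    Fintype.card_fin]
  congr 1
  omega

theorem sum_Iic_vecAB (j : Fin n) :
    ∑ k ∈ Finset.Iic j, VectorParking.vecAB n a b k = a + b * j := by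
  have h0 : (⟨0, j.pos⟩ : Fin n) ∈ Finset.Iic j := Finset.mem_Iic.2 (Nat.zero_le _)
  rw [← Finset.insert_erase h0, Finset.sum_insert (Finset.notMem_erase _ _)]
  have hw : ∀ k ∈ (Finset.Iic j).erase (⟨0, j.pos⟩ : Fin n), VectorParking.vecAB n a b k = b := by
    intro k hk
    refine if_neg fun h => Finset.ne_of_mem_erase hk (Fin.ext h)
  rw [Finset.sum_congr rfl hw, Finset.sum_const, Finset.card_erase_of_mem h0, Fin.card_Iic]
  simp [VectorParking.vecAB, mul_comm]

/-- The graph bound depends only on the size of `U`, so the binding sets of each size are those with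
the largest entries, namely the final segments of the sorted order. -/
theorem vectorIsParking_iff (α : Fin n → ℕ) :
    VectorParking.IsParking (VectorParking.vecAB n a b) α ↔
      ∀ U : Finset (Fin n), U.Nonempty → ∃ i ∈ U, α i < a + b * (n - U.card) := by
  have hmono := Tuple.monotone_sort α
  simp only [VectorParking.IsParking, sum_Iic_vecAB]
  constructor
  · intro h U hU
    -- `j` is the first sorted position occupied by `U`; all of `U` sits at positions from `j` on,
    -- so `j ≤ n - U.card`.
    obtain ⟨j, hj, hmin⟩ := Finset.exists_min_image (U.map (Tuple.sort α).symm.toEmbedding) id hU.map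
    rw [Finset.mem_map_equiv, Equiv.symm_symm] at hj
    refine ⟨_, hj, (h j).trans_le ?_⟩
    have hsub : U.map (Tuple.sort α).symm.toEmbedding ⊆ Finset.Ici j :=
      fun k hk => Finset.mem_Ici.2 (hmin k hk)
    have hcard := Finset.card_le_card hsub
    rw [Finset.card_map, Fin.card_Ici] at hcard
    have := j.2
    gcongr
    omega
  · intro h j
    -- The test set consists of the `n - j` entries at sorted positions `≥ j`, the smallest being
    -- the one at `j`.
    obtain ⟨i, hi, hlt⟩ := h ((Finset.Ici j).map (Tuple.sort α).toEmbedding)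
      (Finset.nonempty_Ici.map)
    obtain ⟨k, hk, rfl⟩ := Finset.mem_map.1 hi
    rw [Finset.card_map, Fin.card_Ici] at hlt
    refine (hmono (Finset.mem_Ici.1 hk)).trans_lt (hlt.trans_le ?_)
    have := j.2
    gcongr
    omega

theorem vectorIsParking_iff_isParking (α : Fin n → ℕ) :
    VectorParking.IsParking (VectorParking.vecAB n a b) α ↔
      (completeAB n a b).IsParking fun i => α (nonRootEquiv n a b i) := by
  rw [vectorIsParking_iff]
  constructor
  · intro h U hU
    obtain ⟨i, hi, hlt⟩ := h (U.map (nonRootEquiv n a b).toEmbedding) hU.map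
    obtain ⟨k, hk, rfl⟩ := Finset.mem_map.1 hi
    refine ⟨k, hk, ?_⟩
    rw [degOut_completeAB n a b U hk]
    simpa using hlt
  · intro h U hU
    obtain ⟨i, hi, hlt⟩ := h (U.map (nonRootEquiv n a b).symm.toEmbedding) hU.map
    rw [degOut_completeAB n a b _ hi, Finset.card_map] at hlt
    exact ⟨_, by simpa [Finset.mem_map_equiv] using hi, hlt⟩

theorem sum_vectorParkingFunctions_eq (hn : 1 ≤ n) :
    ∑ α ∈ VectorParking.parkingFunctions (VectorParking.vecAB n a b),
        (LaurentPolynomial.T (VectorParking.rsum (VectorParking.vecAB n a b) α) :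
          LaurentPolynomial ℤ) =
      ∑ α ∈ (completeAB n a b).parkingFunctions,
        LaurentPolynomial.T ((completeAB n a b).rsum α) := by
  refine Finset.sum_equiv (Equiv.arrowCongr (nonRootEquiv n a b).symm (Equiv.refl ℕ)) ?_ ?_
  · intro α
    rw [mem_parkingFunctions, VectorParking.parkingFunctions, Set.Finite.mem_toFinset]
    exact vectorIsParking_iff_isParking n a b α
  · intro α _
    congr 1
    have hE : ∑ i : Fin n, ((n : ℤ) - (i : ℤ)) * (VectorParking.vecAB n a b i : ℤ) =
        (completeAB n a b).edgeCount := by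
      have h1 := two_mul_sum_vecAB n a b hn
      have h2 := two_mul_edgeCount_completeAB n a b
      linarith
    have hcard : Fintype.card (completeAB n a b).NonRoot = n := by
      rw [Fintype.card_congr (nonRootEquiv n a b), Fintype.card_fin]
    rw [VectorParking.rsum, rsum, hE, hcard]
    congr 1
    exact (Equiv.sum_comp (nonRootEquiv n a b) fun i => (α i : ℤ)).symm

end CompleteAB

end RootedMultigraph

end

theorem mainTheorem4 :
    -- the identity for multigraphs, and its form for simple graphs
    (∀ (V : Type*) [Fintype V] [DecidableEq V] (G : RootedMultigraph V), G.Connected →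
      ∀ (prec : G.NonRoot → G.NonRoot → Prop) [IsStrictTotalOrder G.NonRoot prec],
        (∑ α ∈ G.parkingFunctions, (LaurentPolynomial.T (G.rsum α) : LaurentPolynomial ℤ) =
          ∑ T : G.SpanningTree,
            LaurentPolynomial.T (T.kappa prec : ℤ) * ∏ e ∈ T.edges, qNumber (G.weight e)) ∧
        ((∀ e, G.weight e ≤ 1) →
          ∑ α ∈ G.parkingFunctions, (LaurentPolynomial.T (G.rsum α) : LaurentPolynomial ℤ) =
            ∑ T : G.SpanningTree, LaurentPolynomial.T (T.kappa prec : ℤ))) ∧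
    -- the case of the vector `(a, b, …, b)`
    (∀ n a b : ℕ, 1 ≤ n → 1 ≤ a → 1 ≤ b →
      (∀ α : Fin n → ℕ, VectorParking.IsParking (VectorParking.vecAB n a b) α ↔
        (RootedMultigraph.completeAB n a b).IsParking (fun i => α (Fin.pred i.1 i.2))) ∧
      ∀ (prec : (RootedMultigraph.completeAB n a b).NonRoot →
            (RootedMultigraph.completeAB n a b).NonRoot → Prop)
          [IsStrictTotalOrder (RootedMultigraph.completeAB n a b).NonRoot prec],
        ∑ α ∈ VectorParking.parkingFunctions (VectorParking.vecAB n a b),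
            (LaurentPolynomial.T (VectorParking.rsum (VectorParking.vecAB n a b) α) :
              LaurentPolynomial ℤ) =
          ∑ T : (RootedMultigraph.completeAB n a b).SpanningTree,
            LaurentPolynomial.T (T.kappa prec : ℤ) *
              ∏ e ∈ T.edges, qNumber ((RootedMultigraph.completeAB n a b).weight e)) := by
  refine ⟨fun V _ _ G _ prec _ => ⟨G.sum_parkingFunctions_eq prec, fun hG => ?_⟩,
    fun n a b hn _ _ => ⟨fun α => RootedMultigraph.vectorIsParking_iff_isParking n a b α,
      fun prec _ => ?_⟩⟩
  · rw [G.sum_parkingFunctions_eq prec]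
    exact Finset.sum_congr rfl fun T _ => by
      rw [RootedMultigraph.prod_qNumber_edges_eq_one hG, mul_one]
  · rw [RootedMultigraph.sum_vectorParkingFunctions_eq n a b hn,
      (RootedMultigraph.completeAB n a b).sum_parkingFunctions_eq prec]
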